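/- Let $N\ge 1$ and let $J:\mathbb R^N\to[0,\infty)$ be a measurable, radially symmetric Lévy kernel, i.e. $\int_{\mathbb R^N}J(z)\,(|z|^2\wedge 1)\,dz<\infty$. Put $$\mathcal E(f,g)=\frac12\int_{\mathbb R^N}\!\int_{\mathbb R^N}(f(x)-f(y))(g(x)-g(y))J(x-y)\,dx\,dy,\qquad \mathcal H=\{f\in L^2(\mathbb R^N):\mathcal E(f,f)<\infty\},$$ with $\|f\|_{\mathcal H}^2=\|f\|_2^2+\mathcal E(f,f)$. For $u_0\in L^1(\mathbb R^N)\cap L^2(\mathbb R^N)$, a weak solution of $\partial_tu+\mathcal Lu=0$ for $t>0$, $u(\cdot,0)=u_0$, where $\mathcal Lf(x)=\mathrm{P.V.}\int_{\mathbb R^N}(f(x)-f(y))J(x-y)\,dy$, is a function $u$ with $u\in L^1(\mathbb R^N\times(0,T))\cap L^2((0,T);\mathcal H)$ for every $T>0$ and $$\int_0^\infty\!\int_{\mathbb R^N}u\,\partial_t\varphi\,dx\,dt+\int_{\mathbb R^N}\varphi(x,0)u_0(x)\,dx=\int_0^\infty\mathcal E(u(t),\varphi(t))\,dt$$ for every $\varphi\in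 C^1(\mathbb R^N\times[0,\infty))$ that vanishes when $|x|$ or $t$ is large. Theorem. Let $0<\alpha\le 2$ and assume that there are $c_0,R>0$ with $J(z)\ge c_0|z|^{-N-\alpha}$ for $|z|\ge R$ (no further condition is imposed on $J$ near the origin). Let $1<p<\infty$. Then there is a constant $C>0$, depending only on $N$, $J$, $\alpha$ and $p$, such that for every $u_0\in L^1(\mathbb R^N)\cap L^{\max\{p,2\}}(\mathbb R^N)$ there is a time $t_0>0$, which may depend on $u_0$, with the following property. Every weak solution $u$ with initial value $u_0$ coincides, for almost every $t>0$, with a continuous function $t\mapsto u(t)\in L^2(\mathbb R^N)$ on $[0,\infty)$ with $u(0)=u_0$, and this function satisfies $$\|u(t)\|_p\le C\,t^{-\frac N\alpha\left(\frac1q-\frac1p\right)}\|u_0\|_q\qquad\text{for all } t>t_0 \text{ and all } 1\le q<p.$$ -/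

import Mathlib

open MeasureTheory Set Filter
open scoped ENNReal

noncomputable section

/-- A radially symmetric Lévy kernel on `ℝ^N`: measurable, nonnegative, depending only on `|z|`,
and with `∫ J(z) (|z|² ∧ 1) dz < ∞`. -/
structure IsLevyKernel {N : ℕ} (J : EuclideanSpace ℝ (Fin N) → ℝ) : Prop where
  measurable : Measurable J
  nonneg : ∀ z, 0 ≤ J z
  radial : ∀ z w, ‖z‖ = ‖w‖ → J z = J w
  integrable : Integrable (fun z => J z * min (‖z‖ ^ 2) 1) volume

/-- The quadratic Dirichlet form `𝓔(f, f) = ½ ∬ (f(x) - f(y))² J(x - y) dx dy`, as an element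
of `[0, ∞]`. -/
def dirichletEnergy {N : ℕ} (J f : EuclideanSpace ℝ (Fin N) → ℝ) : ℝ≥0∞ :=
  (1 / 2) * ∫⁻ x, ∫⁻ y, ENNReal.ofReal ((f x - f y) ^ 2 * J (x - y))

/-- The bilinear Dirichlet form `𝓔(f, g) = ½ ∬ (f(x) - f(y)) (g(x) - g(y)) J(x - y) dx dy`.
The integral converges absolutely when `f` and `g` have finite energy. -/
def dirichletForm {N : ℕ} (J f g : EuclideanSpace ℝ (Fin N) → ℝ) : ℝ :=
  (1 / 2) * ∫ z : EuclideanSpace ℝ (Fin N) × EuclideanSpace ℝ (Fin N),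
    (f z.1 - f z.2) * (g z.1 - g z.2) * J (z.1 - z.2)

/-- `u` (written as `u t x`) is a weak solution of `∂ₜu + 𝓛u = 0` in `ℝ^N × (0, ∞)`,
`u(·, 0) = u₀`, where `𝓛` is the operator with Dirichlet form `𝓔`:
for every `T > 0`, `u ∈ L¹(ℝ^N × (0, T)) ∩ L²((0, T); 𝓗)`, where `𝓗` is the space of
`f ∈ L²` with `𝓔(f, f) < ∞` and `‖f‖_𝓗² = ‖f‖₂² + 𝓔(f, f)`, and the equation holds
when tested against every `C¹` function on `ℝ^N × [0, ∞)` (extended to `t < 0`)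
that vanishes when `|x|` or `t` is large. -/
structure IsWeakSolution {N : ℕ} (J u₀ : EuclideanSpace ℝ (Fin N) → ℝ)
    (u : ℝ → EuclideanSpace ℝ (Fin N) → ℝ) : Prop where
  integrable : ∀ T : ℝ, 0 < T →
    Integrable (Function.uncurry u) ((volume.restrict (Ioo 0 T)).prod volume)
  energy_lt_top : ∀ T : ℝ, 0 < T →
    ∫⁻ t in Ioo 0 T, ((eLpNorm (u t) 2 volume) ^ 2 + dirichletEnergy J (u t)) < ∞
  weak_eq : ∀ φ : ℝ → EuclideanSpace ℝ (Fin N) → ℝ,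
    ContDiff ℝ 1 (Function.uncurry φ) → HasCompactSupport (Function.uncurry φ) →
      (∫ t in Ioi (0 : ℝ), ∫ x, u t x * deriv (fun s => φ s x) t) + ∫ x, φ 0 x * u₀ x
        = ∫ t in Ioi (0 : ℝ), dirichletForm J (u t) (φ t)

end

noncomputable section

open scoped Topology

/-! The large jumps alone regularize. For a finite symmetric Lévy measure `ν` the semigroup is `exp
(-t m) exp (t A)`, with `m` the mass and `A` the convolution. If `ν` contains a multiple of Lebesgue
measure on the annulus `D = {r ≤ |z| ≤ 2r}`, its semigroup factors through that of this piece. The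
no-jump part has weight `exp (-t m_D)`, `m_D` being the mass of the piece. The jump part contains at
least one average over `D`, so it maps `L^q` to `L^p` with norm at most `|D| ^ (-(1/q - 1/p))`
(`eLpNorm_semi_le_of_avg`, `eLpNorm_avg_restrict_le`). Since `m_D` is of order `r ^ (-α)`, taking
`r` of order `t ^ (1/α)` keeps `t m_D = K` fixed, and `|D|` is of order `t ^ (N/α)`. This is
`exists_one_step_bound`: the desired decay plus `exp (-K)` times the `L^p` norm.

The small jumps give no smoothing, so the `L^p` term cannot be dropped. Iterating over time
doublings makes it decay like `t ^ (-(N/α + 1))`, faster than any rate required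
(`exists_decay_bound`). For a fixed initial value, `‖u₀‖_p ≤ M ‖u₀‖_q` with `M` independent of `q`,
so the remainder is absorbed once `t` is large. This is the only source of the dependence of `t₀` on
`u₀`.

For a general kernel, the jumps below `1 / (n + 1)` are removed. The bounds do not depend on `n`,
and the semigroups converge in `L²` because the generators converge on smooth functions
(`tendsto_gen_levyCut`, `norm_semi_sub_le`).

It remains to identify a weak solution with the limit semigroup. Testing with `((t - s)⁺)² ψ(x)`
shows that `X(t) = ∫₀ᵗ (t - s)² u(s) ds` solves `X' + 𝓛X = t² u₀` weakly. Translation invariance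
allows `ψ` to be replaced by its image under a truncated semigroup (`Annihilates.inner_semi`).
Duhamel's formula then determines `X`, and differentiating in time recovers `u` almost everywhere
(`toCurve_ae_eq_limSemi`). -/

/-- `ℝ^N` with its Euclidean norm. -/
abbrev Euc (N : ℕ) := EuclideanSpace ℝ (Fin N)

/-- The Hilbert space `L²(ℝ^N)`. -/
abbrev EucL2 (N : ℕ) := Lp ℝ 2 (volume : Measure (Euc N))

/-! ### Translations, symmetric convolution operators and their semigroups on `L²`. -/

namespace NonlocalHeat

variable {N : ℕ}

/-- Translation by `z`: `(shift z f)(x) = f (x - z)`. -/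
def shift (z : Euc N) : EucL2 N →ₗᵢ[ℝ] EucL2 N :=
  Lp.compMeasurePreservingₗᵢ ℝ (fun x => x - z) (measurePreserving_sub_right volume z)

theorem coeFn_shift (z : Euc N) (f : EucL2 N) :
    shift z f =ᵐ[volume] fun x => f (x - z) :=
  Lp.coeFn_compMeasurePreserving f (measurePreserving_sub_right volume z)

theorem continuous_shift (f : EucL2 N) : Continuous fun z => shift z f := by
  have hc : Continuous fun q : Euc N × Euc N => q.2 - q.1 := by fun_prop
  let g : Euc N → C(Euc N, Euc N) := (ContinuousMap.mk _ hc).curry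
  have hg : Continuous g := (ContinuousMap.mk _ hc).curry.continuous
  exact (continuous_const (y := f)).compMeasurePreservingLp hg
    (fun z => measurePreserving_sub_right volume z) (by simp)

theorem ae_eq_comp_sub {f g : Euc N → ℝ} (h : f =ᵐ[volume] g) (z : Euc N) :
    (fun x => f (x - z)) =ᵐ[volume] fun x => g (x - z) :=
  (measurePreserving_sub_right (volume : Measure (Euc N)) z).quasiMeasurePreserving.ae_eq_comp h

theorem shift_add (z w : Euc N) (f : EucL2 N) : shift z (shift w f) = shift (z + w) f := by
  refine Lp.ext ?_
  filter_upwards [coeFn_shift z (shift w f), coeFn_shift (z + w) f,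
    ae_eq_comp_sub (coeFn_shift w f) z] with x h1 h2 h3
  rw [h1, h2, h3, sub_sub]

theorem shift_zero (f : EucL2 N) : shift 0 f = f := by
  refine Lp.ext ?_
  filter_upwards [coeFn_shift 0 f] with x h1
  simp [h1]

theorem inner_shift_left (z : Euc N) (f g : EucL2 N) :
    inner ℝ (shift z f) g = inner ℝ f (shift (-z) g) := by
  rw [← LinearIsometry.inner_map_map (shift z) f, shift_add, add_neg_cancel, shift_zero]

theorem eLpNorm_shift (z : Euc N) (f : EucL2 N) (r : ℝ≥0∞) :
    eLpNorm (shift z f) r volume = eLpNorm f r volume := by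
  rw [eLpNorm_congr_ae (coeFn_shift z f)]
  exact eLpNorm_comp_measurePreserving (Lp.aestronglyMeasurable f)
    (measurePreserving_sub_right volume z)

/-- The mean of the translations by `z` and by `-z`. -/
def symShift (z : Euc N) : EucL2 N →L[ℝ] EucL2 N :=
  (1 / 2 : ℝ) • ((shift z).toContinuousLinearMap + (shift (-z)).toContinuousLinearMap)

theorem symShift_apply (z : Euc N) (f : EucL2 N) :
    symShift z f = (1 / 2 : ℝ) • (shift z f + shift (-z) f) := rfl

theorem continuous_symShift (f : EucL2 N) : Continuous fun z => symShift z f := by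
  simp only [symShift_apply]
  exact ((continuous_shift f).add ((continuous_shift f).comp continuous_neg)).const_smul (1 / 2 : ℝ)

theorem norm_symShift_le (z : Euc N) (f : EucL2 N) : ‖symShift z f‖ ≤ ‖f‖ := by
  rw [symShift_apply, norm_smul]
  have h := norm_add_le (shift z f) (shift (-z) f)
  rw [LinearIsometry.norm_map, LinearIsometry.norm_map] at h
  rw [Real.norm_of_nonneg (by norm_num)]
  linarith

theorem inner_symShift_left (z : Euc N) (f g : EucL2 N) :
    inner ℝ (symShift z f) g = inner ℝ f (symShift z g) := by
  simp only [symShift_apply, real_inner_smul_left, real_inner_smul_right, inner_add_left,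
    inner_add_right, inner_shift_left, neg_neg]
  ring

theorem symShift_shift (z w : Euc N) (f : EucL2 N) :
    symShift z (shift w f) = shift w (symShift z f) := by
  simp only [symShift_apply, map_smul, map_add, shift_add, add_comm w]

theorem symShift_comm (z w : Euc N) (f : EucL2 N) :
    symShift z (symShift w f) = symShift w (symShift z f) := by
  rw [symShift_apply w, map_smul, map_add, symShift_shift, symShift_shift, symShift_apply w]

/-- `‖f - f(· - z)‖² = 2 ⟨f, f - symShift z f⟩`, polarized. -/
theorem inner_sub_shift_sub_shift (z : Euc N) (f g : EucL2 N) :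
    inner ℝ (f - shift z f) (g - shift z g) = 2 * inner ℝ f (g - symShift z g) := by
  simp only [symShift_apply, real_inner_smul_right, inner_add_right, inner_sub_left,
    inner_sub_right, LinearIsometry.inner_map_map]
  rw [inner_shift_left]
  ring

theorem integrable_symShift (ν : Measure (Euc N)) [IsFiniteMeasure ν] (f : EucL2 N) :
    Integrable (fun z => symShift z f) ν :=
  Integrable.of_bound (continuous_symShift f).aestronglyMeasurable ‖f‖
    (Eventually.of_forall fun z => norm_symShift_le z f)

/-- Convolution with the symmetrization of the finite measure `ν`. -/
def avg (ν : Measure (Euc N)) [IsFiniteMeasure ν] : EucL2 N →L[ℝ] EucL2 N :=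
  LinearMap.mkContinuous
    { toFun := fun f => ∫ z, symShift z f ∂ν
      map_add' := fun f g => by
        simp only [map_add]
        exact integral_add (integrable_symShift ν f) (integrable_symShift ν g)
      map_smul' := fun c f => by
        simp only [map_smul, RingHom.id_apply]
        exact integral_smul c _ }
    (ν.real univ)
    (fun f => by
      have := norm_integral_le_of_norm_le_const (μ := ν)
        (Eventually.of_forall fun z => norm_symShift_le z f)
      simpa [mul_comm] using this)

variable (ν ν' : Measure (Euc N)) [IsFiniteMeasure ν] [IsFiniteMeasure ν']

theorem avg_apply (f : EucL2 N) : avg ν f = ∫ z, symShift z f ∂ν := rfl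

/-- A bounded operator passes under the Bochner integral. Translations and averages therefore all
commute, which is what lets the semigroup of a sum of measures factor. -/
theorem avg_comp_of_comm (T : EucL2 N →L[ℝ] EucL2 N)
    (hT : ∀ z f, T (symShift z f) = symShift z (T f)) (f : EucL2 N) :
    T (avg ν f) = avg ν (T f) := by
  rw [avg_apply, avg_apply, ← ContinuousLinearMap.integral_comp_comm T (integrable_symShift ν f)]
  simp only [hT]

theorem avg_symShift (z : Euc N) (f : EucL2 N) :
    avg ν (symShift z f) = symShift z (avg ν f) :=
  (avg_comp_of_comm ν (symShift z) (fun w g => symShift_comm z w g) f).symm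

theorem avg_shift (z : Euc N) (f : EucL2 N) :
    avg ν (shift z f) = shift z (avg ν f) :=
  (avg_comp_of_comm ν (shift z).toContinuousLinearMap
    (fun w g => (symShift_shift w z g).symm) f).symm

theorem commute_avg : Commute (avg ν) (avg ν') := by
  refine ContinuousLinearMap.ext fun f => ?_
  exact avg_comp_of_comm ν' (avg ν) (fun z g => avg_symShift ν z g) f

theorem avg_add_measure : avg (ν + ν') = avg ν + avg ν' := by
  refine ContinuousLinearMap.ext fun f => ?_
  exact integral_add_measure (integrable_symShift ν f) (integrable_symShift ν' f)

theorem inner_avg_left (f g : EucL2 N) : inner ℝ (avg ν f) g = inner ℝ f (avg ν g) := by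
  rw [avg_apply, avg_apply, ← integral_inner (integrable_symShift ν g), real_inner_comm,
    ← integral_inner (integrable_symShift ν f)]
  refine integral_congr_ae (Eventually.of_forall fun z => ?_)
  change inner ℝ g (symShift z f) = inner ℝ f (symShift z g)
  rw [real_inner_comm, inner_symShift_left]

/-- The bounded nonlocal operator `f ↦ ∫ (f - f(· - z)) dν(z)` (symmetrized). -/
def gen : EucL2 N →L[ℝ] EucL2 N := ν.real univ • 1 - avg ν

theorem gen_apply (f : EucL2 N) : gen ν f = ν.real univ • f - avg ν f := rfl

theorem gen_eq_integral (f : EucL2 N) : gen ν f = ∫ z, (f - symShift z f) ∂ν := by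
  rw [integral_sub (integrable_const f) (integrable_symShift ν f), gen_apply, avg_apply,
    integral_const]

theorem commute_gen : Commute (gen ν) (gen ν') := by
  unfold gen
  refine Commute.sub_left ?_ ?_
  · exact ((Commute.one_left _).smul_left _)
  · exact Commute.sub_right ((Commute.one_right _).smul_right _) (commute_avg ν ν')

theorem gen_add_measure : gen (ν + ν') = gen ν + gen ν' := by
  unfold gen
  rw [avg_add_measure, measureReal_add_apply, add_smul]
  abel

theorem inner_gen_left (f g : EucL2 N) : inner ℝ (gen ν f) g = inner ℝ f (gen ν g) := by
  rw [gen_apply, gen_apply, inner_sub_left, inner_sub_right, inner_avg_left,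
    real_inner_smul_left, real_inner_smul_right]

/-- The semigroup `exp (-t (gen ν))`. -/
def semi (t : ℝ) : EucL2 N →L[ℝ] EucL2 N := NormedSpace.exp ((-t) • gen ν)

theorem exp_add_commute {T T' : EucL2 N →L[ℝ] EucL2 N} (h : Commute T T') :
    NormedSpace.exp (T + T') = NormedSpace.exp T * NormedSpace.exp T' := by
  let _ : NormedAlgebra ℚ (EucL2 N →L[ℝ] EucL2 N) := .restrictScalars ℚ ℝ _
  exact NormedSpace.exp_add_of_commute h

theorem semi_zero : semi ν 0 = 1 := by
  simp [semi, NormedSpace.exp_zero]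

theorem semi_add (s t : ℝ) : semi ν (s + t) = semi ν s * semi ν t := by
  unfold semi
  rw [neg_add, add_smul]
  exact exp_add_commute (((Commute.refl _).smul_left _).smul_right _)

theorem semi_add_measure (t : ℝ) : semi (ν + ν') t = semi ν t * semi ν' t := by
  unfold semi
  rw [gen_add_measure, smul_add]
  exact exp_add_commute (((commute_gen ν ν').smul_left _).smul_right _)

theorem commute_of_commute_gen {T : EucL2 N →L[ℝ] EucL2 N} (h : Commute T (gen ν)) (t : ℝ) :
    Commute T (semi ν t) := by
  let _ : NormedAlgebra ℚ (EucL2 N →L[ℝ] EucL2 N) := .restrictScalars ℚ ℝ _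
  exact Commute.exp_right (h.smul_right _)

theorem hasDerivAt_semi (t : ℝ) : HasDerivAt (semi ν) (-(semi ν t * gen ν)) t := by
  have h := (hasDerivAt_exp_smul_const (𝕂 := ℝ) (gen ν) (-t)).scomp t (hasDerivAt_neg t)
  have hs : semi ν = fun s => NormedSpace.exp ((-s) • gen ν) := rfl
  rw [hs]
  simpa [Function.comp_def] using h

theorem hasSum_exp_apply (T : EucL2 N →L[ℝ] EucL2 N) (f : EucL2 N) :
    HasSum (fun n : ℕ => (n.factorial : ℝ)⁻¹ • (T ^ n) f) (NormedSpace.exp T f) := by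
  have h := NormedSpace.exp_series_hasSum_exp' (𝕂 := ℝ) T
  exact h.mapL (ContinuousLinearMap.apply ℝ (EucL2 N) f)

theorem inner_exp_left {T : EucL2 N →L[ℝ] EucL2 N}
    (hT : ∀ f g, inner ℝ (T f) g = inner ℝ f (T g)) (f g : EucL2 N) :
    inner ℝ (NormedSpace.exp T f) g = inner ℝ f (NormedSpace.exp T g) := by
  have hpow : ∀ n : ℕ, ∀ f g, inner ℝ ((T ^ n) f) g = inner ℝ f ((T ^ n) g) := by
    intro n
    induction n with
    | zero => intro f g; rfl
    | succ n ih =>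
      intro f g
      rw [pow_succ, mul_apply_eq_comp, ih, hT, ← mul_apply_eq_comp,
        ← pow_succ', pow_succ]
  have h1 := (hasSum_exp_apply T f).mapL (innerSL ℝ g)
  have h2 := (hasSum_exp_apply T g).mapL (innerSL ℝ f)
  have h3 : (fun n : ℕ => innerSL ℝ g ((n.factorial : ℝ)⁻¹ • (T ^ n) f))
      = fun n : ℕ => innerSL ℝ f ((n.factorial : ℝ)⁻¹ • (T ^ n) g) := by
    funext n
    simp only [innerSL_apply_apply, real_inner_smul_right]
    rw [real_inner_comm, hpow]
  rw [h3] at h1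
  have := h1.unique h2
  simp only [innerSL_apply_apply] at this
  rw [real_inner_comm, this]

theorem inner_semi_left (t : ℝ) (f g : EucL2 N) :
    inner ℝ (semi ν t f) g = inner ℝ f (semi ν t g) := by
  refine inner_exp_left (fun f g => ?_) f g
  simp only [smul_apply, real_inner_smul_left, real_inner_smul_right,
    inner_gen_left]

end NonlocalHeat

/-! ### Contraction in `L^r` and the splitting of the semigroup by the number of jumps. -/

namespace NonlocalHeat

variable {N : ℕ}

theorem eLpNorm_coe_smul (c : ℝ) (f : EucL2 N) (r : ℝ≥0∞) :
    eLpNorm (c • f : EucL2 N) r volume = ‖c‖ₑ * eLpNorm f r volume := by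
  rw [eLpNorm_congr_ae (Lp.coeFn_smul c f), eLpNorm_const_smul]

theorem eLpNorm_coe_add_le (f g : EucL2 N) {r : ℝ≥0∞} (hr : 1 ≤ r) :
    eLpNorm (f + g : EucL2 N) r volume ≤ eLpNorm f r volume + eLpNorm g r volume := by
  rw [eLpNorm_congr_ae (Lp.coeFn_add f g)]
  exact eLpNorm_add_le (Lp.aestronglyMeasurable f) (Lp.aestronglyMeasurable g) hr

theorem eLpNorm_coe_zero (r : ℝ≥0∞) : eLpNorm (0 : EucL2 N) r volume = 0 := by
  rw [eLpNorm_congr_ae (Lp.coeFn_zero ℝ 2 volume), eLpNorm_zero]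

/-- Fatou along an almost everywhere convergent subsequence. This is how `L^r` bounds survive `L²`
limits: means, series, and later the removal of the truncation. -/
theorem isClosed_setOf_eLpNorm_le (r c : ℝ≥0∞) :
    IsClosed {g : EucL2 N | eLpNorm g r volume ≤ c} := by
  refine IsSeqClosed.isClosed fun f g hf hg => ?_
  obtain ⟨ns, -, hns⟩ := (tendstoInMeasure_of_tendsto_Lp hg).exists_seq_tendsto_ae
  refine (Lp.eLpNorm_lim_le_liminf_eLpNorm (p := r)
    (fun n => Lp.aestronglyMeasurable (f (ns n))) g hns).trans ?_
  exact (liminf_le_liminf (Eventually.of_forall fun n => hf (ns n))).trans (by simp)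

theorem convex_setOf_eLpNorm_le {r : ℝ≥0∞} (hr : 1 ≤ r) (c : ℝ≥0∞) :
    Convex ℝ {g : EucL2 N | eLpNorm g r volume ≤ c} := by
  intro f hf g hg a b ha hb hab
  refine (eLpNorm_coe_add_le _ _ hr).trans ?_
  rw [eLpNorm_coe_smul, eLpNorm_coe_smul, Real.enorm_of_nonneg ha, Real.enorm_of_nonneg hb]
  calc _ ≤ ENNReal.ofReal a * c + ENNReal.ofReal b * c := by gcongr <;> assumption
    _ = c := by rw [← add_mul, ← ENNReal.ofReal_add ha hb, hab, ENNReal.ofReal_one, one_mul]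

theorem eLpNorm_symShift_le (z : Euc N) (f : EucL2 N) {r : ℝ≥0∞} (hr : 1 ≤ r) :
    eLpNorm (symShift z f) r volume ≤ eLpNorm f r volume := by
  rw [symShift_apply, smul_add]
  exact convex_setOf_eLpNorm_le hr _ (eLpNorm_shift z f r).le (eLpNorm_shift (-z) f r).le
    (by norm_num) (by norm_num) (by norm_num)

variable (ν ν' : Measure (Euc N)) [IsFiniteMeasure ν] [IsFiniteMeasure ν']

/-- After normalizing `ν`, the mean of the translates lies in the closed convex set of functions
whose `L^r` norm is at most that of `f`. -/
theorem eLpNorm_avg_le (f : EucL2 N) {r : ℝ≥0∞} (hr : 1 ≤ r) :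
    eLpNorm (avg ν f) r volume ≤ ν univ * eLpNorm f r volume := by
  rcases eq_zero_or_neZero ν with h | h
  · subst h
    rw [avg_apply, integral_zero_measure, eLpNorm_coe_zero]
    exact zero_le
  · have h1 : avg ν f = ν.real univ • ⨍ z, symShift z f ∂ν := by
      rw [average_eq, smul_smul, mul_inv_cancel₀, one_smul, avg_apply]
      exact (measureReal_ne_zero_iff).2 (NeZero.ne _)
    have h2 := Convex.average_mem (convex_setOf_eLpNorm_le hr (eLpNorm f r volume))
      (isClosed_setOf_eLpNorm_le r _)
      (Eventually.of_forall fun z => eLpNorm_symShift_le z f hr) (integrable_symShift ν f)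
    rw [h1, eLpNorm_coe_smul, Real.enorm_of_nonneg measureReal_nonneg,
      ofReal_measureReal]
    gcongr
    exact h2

theorem eLpNorm_le_tsum_of_hasSum {a : ℕ → EucL2 N} {f : EucL2 N} (h : HasSum a f)
    {r : ℝ≥0∞} (hr : 1 ≤ r) {b : ℕ → ℝ≥0∞} (hb : ∀ n, eLpNorm (a n) r volume ≤ b n) :
    eLpNorm f r volume ≤ ∑' n, b n := by
  refine (isClosed_setOf_eLpNorm_le r (∑' n, b n)).mem_of_tendsto h (Eventually.of_forall fun s => ?_)
  refine le_trans ?_ (ENNReal.sum_le_tsum s)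
  induction s using Finset.cons_induction with
  | empty =>
    simp only [Finset.sum_empty]
    exact (eLpNorm_coe_zero r).le
  | cons i s hi ih =>
    rw [Finset.sum_cons, Finset.sum_cons]
    exact (eLpNorm_coe_add_le _ _ hr).trans (add_le_add (hb i) ih)

theorem tsum_ofReal_pow_div_factorial {K : ℝ} (hK : 0 ≤ K) :
    ∑' n : ℕ, ENNReal.ofReal (K ^ n / n.factorial) = ENNReal.ofReal (Real.exp K) := by
  rw [Real.exp_eq_exp_ℝ, NormedSpace.exp_eq_tsum_div,
    ENNReal.ofReal_tsum_of_nonneg (fun n => by positivity)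
      (Real.summable_pow_div_factorial K)]

theorem eLpNorm_exp_term_le {T : EucL2 N →L[ℝ] EucL2 N} {f : EucL2 N} {r c : ℝ≥0∞} {K : ℝ}
    (hK : 0 ≤ K) {n : ℕ} (h : eLpNorm ((T ^ n) f) r volume ≤ ENNReal.ofReal K ^ n * c) :
    eLpNorm ((n.factorial : ℝ)⁻¹ • (T ^ n) f : EucL2 N) r volume
      ≤ ENNReal.ofReal (K ^ n / n.factorial) * c := by
  rw [eLpNorm_coe_smul, Real.enorm_of_nonneg (by positivity), div_eq_inv_mul,
    ENNReal.ofReal_mul (by positivity), ENNReal.ofReal_pow hK, mul_assoc]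
  gcongr

theorem eLpNorm_exp_le {T : EucL2 N →L[ℝ] EucL2 N} {f : EucL2 N} {r c : ℝ≥0∞} (hr : 1 ≤ r)
    {K : ℝ} (hK : 0 ≤ K) (h : ∀ n : ℕ, eLpNorm ((T ^ n) f) r volume ≤ ENNReal.ofReal K ^ n * c) :
    eLpNorm (NormedSpace.exp T f) r volume ≤ ENNReal.ofReal (Real.exp K) * c := by
  refine (eLpNorm_le_tsum_of_hasSum (hasSum_exp_apply T f) hr
    fun n => eLpNorm_exp_term_le hK (h n)).trans ?_
  rw [ENNReal.tsum_mul_right, tsum_ofReal_pow_div_factorial hK]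

/-- Subtracting `f` removes the term `n = 0`, so a bound is needed only for positive powers. These
contain at least one smoothing factor. -/
theorem eLpNorm_exp_sub_le {T : EucL2 N →L[ℝ] EucL2 N} {f : EucL2 N} {r c : ℝ≥0∞} (hr : 1 ≤ r)
    {K : ℝ} (hK : 0 ≤ K)
    (h : ∀ n : ℕ, eLpNorm ((T ^ (n + 1)) f) r volume ≤ ENNReal.ofReal K ^ (n + 1) * c) :
    eLpNorm (NormedSpace.exp T f - f : EucL2 N) r volume ≤ ENNReal.ofReal (Real.exp K) * c := by
  have h1 := (hasSum_nat_add_iff' 1).2 (hasSum_exp_apply T f)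
  simp only [Finset.range_one, Finset.sum_singleton, Nat.factorial_zero, Nat.cast_one, inv_one,
    pow_zero, one_smul] at h1
  refine (eLpNorm_le_tsum_of_hasSum h1 hr fun n => eLpNorm_exp_term_le hK (h n)).trans ?_
  rw [ENNReal.tsum_mul_right, ← tsum_ofReal_pow_div_factorial hK]
  refine mul_le_mul' ?_ le_rfl
  exact ENNReal.tsum_comp_le_tsum_of_injective (add_left_injective 1)
    fun n : ℕ => ENNReal.ofReal (K ^ n / n.factorial)

theorem eLpNorm_smul_avg_pow_le {t : ℝ} (ht : 0 ≤ t) (n : ℕ) (f : EucL2 N) {r : ℝ≥0∞}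
    (hr : 1 ≤ r) : eLpNorm (((t • avg ν) ^ n) f) r volume
      ≤ ENNReal.ofReal (t * ν.real univ) ^ n * eLpNorm f r volume := by
  induction n with
  | zero => simp
  | succ n ih =>
    rw [pow_succ', mul_apply_eq_comp, smul_apply, eLpNorm_coe_smul,
      Real.enorm_of_nonneg ht, pow_succ', ENNReal.ofReal_mul ht, ofReal_measureReal, mul_assoc,
      mul_assoc]
    gcongr
    refine (eLpNorm_avg_le ν _ hr).trans ?_
    gcongr
    rwa [ENNReal.ofReal_mul ht, ofReal_measureReal] at ih

/-- The compound Poisson form: the scalar part of the generator commutes with the average and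
exponentiates separately. -/
theorem semi_eq (t : ℝ) :
    semi ν t = Real.exp (-(t * ν.real univ)) • NormedSpace.exp (t • avg ν) := by
  have h1 : (-t) • gen ν = algebraMap ℝ (EucL2 N →L[ℝ] EucL2 N) (-(t * ν.real univ)) + t • avg ν := by
    rw [Algebra.algebraMap_eq_smul_one]
    refine ContinuousLinearMap.ext fun f => ?_
    change (-t) • (ν.real univ • f - avg ν f) = (-(t * ν.real univ)) • f + t • avg ν f
    module
  rw [semi, h1, exp_add_commute (Algebra.commutes _ _),
    ← NormedSpace.algebraMap_exp_comm (𝕂 := ℝ) (-(t * ν.real univ)), ← Algebra.smul_def,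
    Real.exp_eq_exp_ℝ]

theorem eLpNorm_semi_le {t : ℝ} (ht : 0 ≤ t) (f : EucL2 N) {r : ℝ≥0∞} (hr : 1 ≤ r) :
    eLpNorm (semi ν t f) r volume ≤ eLpNorm f r volume := by
  have h := eLpNorm_exp_le hr (by positivity) fun n => eLpNorm_smul_avg_pow_le ν ht n f hr
  rw [semi_eq, smul_apply, eLpNorm_coe_smul, Real.enorm_of_nonneg (Real.exp_pos _).le]
  calc _ ≤ ENNReal.ofReal (Real.exp (-(t * ν.real univ))) * (ENNReal.ofReal (Real.exp (t * ν.real univ))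
        * eLpNorm f r volume) := by gcongr
    _ = _ := by
      rw [← mul_assoc, ← ENNReal.ofReal_mul (Real.exp_pos _).le, ← Real.exp_add, neg_add_cancel,
        Real.exp_zero, ENNReal.ofReal_one, one_mul]

theorem norm_semi_le {t : ℝ} (ht : 0 ≤ t) (f : EucL2 N) : ‖semi ν t f‖ ≤ ‖f‖ := by
  rw [Lp.norm_def, Lp.norm_def]
  exact ENNReal.toReal_mono (Lp.eLpNorm_ne_top f) (eLpNorm_semi_le ν ht f (by norm_num))

/-- A bound of the convolution with `ν` from `L^q` to `L^p` passes to the jump part of the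
semigroup. -/
theorem eLpNorm_semi_le_of_avg {t : ℝ} (ht : 0 ≤ t) (f : EucL2 N) {r c : ℝ≥0∞} (hr : 1 ≤ r)
    (h : eLpNorm (avg ν f) r volume ≤ ν univ * c) :
    eLpNorm (semi ν t f) r volume
      ≤ ENNReal.ofReal (Real.exp (-(t * ν.real univ))) * eLpNorm f r volume + c := by
  -- Only the innermost average uses `h`; the other `n` factors are bounded on `L^r` by the mass.
  have h1 : ∀ n : ℕ, eLpNorm (((t • avg ν) ^ (n + 1)) f) r volume
      ≤ ENNReal.ofReal (t * ν.real univ) ^ (n + 1) * c := by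
    intro n
    rw [pow_succ, mul_apply_eq_comp, pow_succ, mul_assoc]
    refine (eLpNorm_smul_avg_pow_le ν ht n _ hr).trans ?_
    gcongr
    rw [smul_apply, eLpNorm_coe_smul, Real.enorm_of_nonneg ht, ENNReal.ofReal_mul ht,
      ofReal_measureReal, mul_assoc]
    gcongr
  have h2 := eLpNorm_exp_sub_le hr (by positivity) h1
  have h3 : semi ν t f = Real.exp (-(t * ν.real univ)) • f
      + Real.exp (-(t * ν.real univ)) • (NormedSpace.exp (t • avg ν) f - f) := by
    rw [semi_eq, smul_apply, ← smul_add, add_sub_cancel]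
  rw [h3]
  refine (eLpNorm_coe_add_le _ _ hr).trans ?_
  rw [eLpNorm_coe_smul, eLpNorm_coe_smul, Real.enorm_of_nonneg (Real.exp_pos _).le]
  gcongr
  calc _ ≤ ENNReal.ofReal (Real.exp (-(t * ν.real univ)))
        * (ENNReal.ofReal (Real.exp (t * ν.real univ)) * c) := by gcongr
    _ = _ := by
      rw [← mul_assoc, ← ENNReal.ofReal_mul (Real.exp_pos _).le, ← Real.exp_add, neg_add_cancel,
        Real.exp_zero, ENNReal.ofReal_one, one_mul]

end NonlocalHeat

/-! ### Averages over a set of finite volume map `L^q` to `L^p`. -/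

namespace NonlocalHeat

variable {N : ℕ}

theorem measurePreserving_const_sub (x : Euc N) :
    MeasurePreserving (fun z : Euc N => x - z) volume volume := by
  simpa [sub_eq_add_neg, Function.comp_def] using
    (measurePreserving_add_left (volume : Measure (Euc N)) x).comp
      (Measure.measurePreserving_neg (volume : Measure (Euc N)))

/-- Tonelli, then Hölder on `D` for each fixed `x`. The map `e` will be the identity or the
reflection, to cover both halves of `symShift`. -/
theorem lintegral_lintegral_shift_le {D s : Set (Euc N)} (f : EucL2 N) {e : Euc N → Euc N}
    (he : MeasurePreserving e volume volume) {q : ℝ} (hq : 1 ≤ q) :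
    ∫⁻ z in D, ∫⁻ x in s, ‖f (x - e z)‖ₑ
      ≤ volume s * (eLpNorm f (ENNReal.ofReal q) volume * volume D ^ (1 - 1 / q)) := by
  have hf := Lp.stronglyMeasurable f
  have hm : Measurable fun w : Euc N × Euc N => ‖f (w.2 - e w.1)‖ₑ :=
    hf.enorm.comp (measurable_snd.sub (he.measurable.comp measurable_fst))
  rw [lintegral_lintegral_swap hm.aemeasurable]
  calc _ ≤ ∫⁻ x in s, (eLpNorm f (ENNReal.ofReal q) volume * volume D ^ (1 - 1 / q)) := by
        refine lintegral_mono fun x => ?_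
        have hx : MeasurePreserving (fun z => x - e z) volume volume :=
          (measurePreserving_const_sub x).comp he
        have h1 := eLpNorm_le_eLpNorm_mul_rpow_measure_univ (μ := volume.restrict D)
          (f := fun z => f (x - e z)) (p := 1) (q := ENNReal.ofReal q)
          (by simpa using ENNReal.ofReal_le_ofReal hq)
          (hf.comp_measurable hx.measurable).aestronglyMeasurable
        rw [eLpNorm_one_eq_lintegral_enorm, ENNReal.toReal_ofReal (by linarith),
          Measure.restrict_apply_univ, ENNReal.toReal_one, div_one] at h1
        refine h1.trans ?_
        gcongr
        refine (eLpNorm_restrict_le _ _ _ _).trans (le_of_eq ?_)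
        exact eLpNorm_comp_measurePreserving hf.aestronglyMeasurable hx
    _ = _ := by rw [setLIntegral_const, mul_comm]

theorem enorm_inner_indicator_shift_le {s : Set (Euc N)} (hs : MeasurableSet s)
    (hμs : volume s ≠ ∞) (z : Euc N) (f : EucL2 N) :
    ‖inner ℝ (indicatorConstLp 2 hs hμs 1) (shift z f)‖ₑ ≤ ∫⁻ x in s, ‖f (x - z)‖ₑ := by
  rw [L2.inner_indicatorConstLp_one]
  refine (enorm_integral_le_lintegral_enorm _).trans (le_of_eq ?_)
  refine lintegral_congr_ae (ae_restrict_of_ae ?_)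
  filter_upwards [coeFn_shift z f] with x hx
  rw [hx]

theorem enorm_inner_indicator_symShift_le {s : Set (Euc N)} (hs : MeasurableSet s)
    (hμs : volume s ≠ ∞) (z : Euc N) (f : EucL2 N) :
    ‖inner ℝ (indicatorConstLp 2 hs hμs 1) (symShift z f)‖ₑ
      ≤ ENNReal.ofReal (1 / 2) * ((∫⁻ x in s, ‖f (x - z)‖ₑ) + ∫⁻ x in s, ‖f (x - -z)‖ₑ) := by
  rw [symShift_apply, real_inner_smul_right, inner_add_right, enorm_mul,
    Real.enorm_of_nonneg (by norm_num)]
  gcongr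
  exact (enorm_add_le _ _).trans (add_le_add (enorm_inner_indicator_shift_le hs hμs z f)
    (enorm_inner_indicator_shift_le hs hμs (-z) f))

variable (a : ℝ) (D : Set (Euc N))

theorem isFiniteMeasure_smul_restrict (hD : volume D ≠ ∞) :
    IsFiniteMeasure (ENNReal.ofReal a • (volume : Measure (Euc N)).restrict D) :=
  ⟨by simpa using ENNReal.mul_lt_top ENNReal.ofReal_lt_top (lt_top_iff_ne_top.2 hD)⟩

variable {a D}

/-- Since `avg` is an `L²`-valued Bochner integral, it is tested against indicators rather than
evaluated pointwise. The factor `volume s` is what yields an essential bound. -/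
theorem enorm_setIntegral_avg_le [IsFiniteMeasure (ENNReal.ofReal a • (volume : Measure (Euc N)).restrict D)]
    {s : Set (Euc N)} (hs : MeasurableSet s) (hμs : volume s ≠ ∞) (f : EucL2 N) {q : ℝ}
    (hq : 1 ≤ q) :
    ‖∫ x in s, avg (ENNReal.ofReal a • (volume : Measure (Euc N)).restrict D) f x‖ₑ
      ≤ volume s * (ENNReal.ofReal a
        * (eLpNorm f (ENNReal.ofReal q) volume * volume D ^ (1 - 1 / q))) := by
  set M := eLpNorm f (ENNReal.ofReal q) volume * volume D ^ (1 - 1 / q) with hM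
  rw [← L2.inner_indicatorConstLp_one (𝕜 := ℝ) hs hμs, avg_apply,
    ← integral_inner (integrable_symShift _ f)]
  have hf := Lp.stronglyMeasurable f
  have hm : Measurable fun z : Euc N => ∫⁻ x in s, ‖f (x - z)‖ₑ :=
    Measurable.lintegral_prod_right' (f := fun w : Euc N × Euc N => ‖f (w.2 - w.1)‖ₑ)
      (hf.enorm.comp (measurable_snd.sub measurable_fst))
  calc _ ≤ ∫⁻ z, ENNReal.ofReal (1 / 2)
          * ((∫⁻ x in s, ‖f (x - z)‖ₑ) + ∫⁻ x in s, ‖f (x - -z)‖ₑ)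
          ∂(ENNReal.ofReal a • (volume : Measure (Euc N)).restrict D) :=
        (enorm_integral_le_lintegral_enorm _).trans
          (lintegral_mono fun z => enorm_inner_indicator_symShift_le hs hμs z f)
    _ = ENNReal.ofReal a * (ENNReal.ofReal (1 / 2) * ((∫⁻ z in D, ∫⁻ x in s, ‖f (x - z)‖ₑ)
          + ∫⁻ z in D, ∫⁻ x in s, ‖f (x - -z)‖ₑ)) := by
        rw [lintegral_smul_measure, lintegral_const_mul' _ _ ENNReal.ofReal_ne_top,
          lintegral_add_left hm, smul_eq_mul]
    _ ≤ ENNReal.ofReal a * (ENNReal.ofReal (1 / 2) * (volume s * M + volume s * M)) := by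
        gcongr
        · exact lintegral_lintegral_shift_le f (e := id) (MeasurePreserving.id _) hq
        · exact lintegral_lintegral_shift_le f (e := fun z => -z)
            (Measure.measurePreserving_neg _) hq
    _ = _ := by
        rw [mul_add, ← add_mul, ← ENNReal.ofReal_add (by norm_num) (by norm_num), add_halves,
          ENNReal.ofReal_one, one_mul]
        ring

theorem eLpNorm_top_le_of_setIntegral {g : EucL2 N} {M : ℝ≥0∞}
    (h : ∀ s : Set (Euc N), MeasurableSet s → volume s < ∞ →
      ‖∫ x in s, g x‖ₑ ≤ volume s * M) :
    eLpNorm g ∞ volume ≤ M := by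
  by_cases hM : M = ∞
  · simp [hM]
  have hint : ∀ s : Set (Euc N), MeasurableSet s → volume s < ∞ → IntegrableOn g s volume := by
    intro s _ hμs
    have : IsFiniteMeasure (volume.restrict s) := ⟨by simpa using hμs⟩
    exact (MemLp.restrict s (Lp.memLp g)).integrable (by norm_num)
  have hb : ∀ s : Set (Euc N), MeasurableSet s → volume s < ∞ →
      |∫ x in s, g x| ≤ volume.real s * M.toReal := by
    intro s hs hμs
    have h1 := ENNReal.toReal_mono (ENNReal.mul_ne_top hμs.ne hM) (h s hs hμs)
    rwa [toReal_enorm, ENNReal.toReal_mul, Real.norm_eq_abs] at h1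
  have hconst : ∀ s : Set (Euc N), volume s < ∞ →
      IntegrableOn (fun _ => M.toReal) s (volume : Measure (Euc N)) :=
    fun s hμs => integrableOn_const hμs.ne
  have h1 : 0 ≤ᵐ[volume] fun x => M.toReal - g x := by
    refine ae_nonneg_of_forall_setIntegral_nonneg_of_sigmaFinite
      (fun s hs hμs => (hconst s hμs).sub (hint s hs hμs)) fun s hs hμs => ?_
    rw [integral_sub (hconst s hμs) (hint s hs hμs), setIntegral_const, smul_eq_mul]
    linarith [(abs_le.1 (hb s hs hμs)).2]
  have h2 : 0 ≤ᵐ[volume] fun x => M.toReal + g x := by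
    refine ae_nonneg_of_forall_setIntegral_nonneg_of_sigmaFinite
      (fun s hs hμs => (hconst s hμs).add (hint s hs hμs)) fun s hs hμs => ?_
    rw [integral_add (hconst s hμs) (hint s hs hμs), setIntegral_const, smul_eq_mul]
    linarith [(abs_le.1 (hb s hs hμs)).1]
  rw [eLpNorm_exponent_top, ← ENNReal.ofReal_toReal hM]
  refine eLpNormEssSup_le_of_ae_bound ?_
  filter_upwards [h1, h2] with x hx1 hx2
  simp only [Pi.zero_apply] at hx1 hx2
  rw [Real.norm_eq_abs, abs_le]
  constructor <;> linarith

theorem eLpNorm_le_interp_top {g : Euc N → ℝ}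
    (hg : AEStronglyMeasurable g volume) {q p : ℝ} (hq : 1 ≤ q) (hqp : q < p) : eLpNorm g (ENNReal.ofReal p) volume
      ≤ eLpNorm g ∞ volume ^ (1 - q / p) * eLpNorm g (ENNReal.ofReal q) volume ^ (q / p) := by
  have hp : 0 < p := by linarith
  have hq0 : 0 < q := by linarith
  rw [eLpNorm_eq_lintegral_rpow_enorm_toReal (by simpa using hp) ENNReal.ofReal_ne_top,
    eLpNorm_eq_lintegral_rpow_enorm_toReal (by simpa using hq0) ENNReal.ofReal_ne_top,
    ENNReal.toReal_ofReal hp.le, ENNReal.toReal_ofReal hq0.le, eLpNorm_exponent_top]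
  set M := eLpNormEssSup g (volume : Measure (Euc N)) with hM
  have h1 : ∫⁻ x, ‖g x‖ₑ ^ p ≤ M ^ (p - q) * ∫⁻ x, ‖g x‖ₑ ^ q := by
    by_cases h0 : M = 0
    · have : g =ᵐ[volume] 0 := eLpNormEssSup_eq_zero_iff.1 (hM ▸ h0)
      rw [lintegral_congr_ae (g := fun _ => 0), lintegral_zero]
      · exact zero_le
      · filter_upwards [this] with x hx
        simp [hx, hp]
    · rw [← lintegral_const_mul'' _ (hg.enorm.pow_const q)]
      refine lintegral_mono_ae ?_
      filter_upwards [ae_le_eLpNormEssSup (f := g) (μ := volume)] with x hx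
      calc ‖g x‖ₑ ^ p = ‖g x‖ₑ ^ (p - q) * ‖g x‖ₑ ^ q := by
            rw [← ENNReal.rpow_add_of_nonneg _ _ (by linarith) hq0.le, sub_add_cancel]
        _ ≤ _ := by gcongr
  calc _ ≤ (M ^ (p - q) * ∫⁻ x, ‖g x‖ₑ ^ q) ^ (1 / p) := by gcongr
    _ = _ := by
      rw [ENNReal.mul_rpow_of_nonneg _ _ (by positivity), ← ENNReal.rpow_mul, ← ENNReal.rpow_mul]
      congr 2 <;> field_simp

/-- Averaging over a set of volume `V` maps `L^q` to `L^p` with norm `V ^ (-(1/q - 1/p))`. -/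
theorem eLpNorm_avg_restrict_le
    [IsFiniteMeasure (ENNReal.ofReal a • (volume : Measure (Euc N)).restrict D)]
    (hD0 : volume D ≠ 0) (hD : volume D ≠ ∞) (f : EucL2 N) {q p : ℝ} (hq : 1 ≤ q) (hqp : q < p) :
    eLpNorm (avg (ENNReal.ofReal a • (volume : Measure (Euc N)).restrict D) f)
      (ENNReal.ofReal p) volume
      ≤ (ENNReal.ofReal a • (volume : Measure (Euc N)).restrict D) univ
        * (volume D ^ (-(1 / q - 1 / p)) * eLpNorm f (ENNReal.ofReal q) volume) := by
  have hp : 0 < p := by linarith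
  have hq0 : 0 < q := by linarith
  have hqp1 : q / p ≤ 1 := (div_le_one hp).2 hqp.le
  set F := eLpNorm f (ENNReal.ofReal q) volume
  set A := ENNReal.ofReal a
  -- With `V = volume D`, the average maps `L^q` to `L^∞` with norm at most `a V ^ (1 - 1/q)` and to
  -- itself with norm at most `a V`; the claim interpolates between the two.
  have h1 := eLpNorm_top_le_of_setIntegral fun s hs hμs =>
    enorm_setIntegral_avg_le (a := a) (D := D) hs hμs.ne f hq
  have h2 := eLpNorm_avg_le (A • (volume : Measure (Euc N)).restrict D) f
    (r := ENNReal.ofReal q) (by simpa using ENNReal.ofReal_le_ofReal hq)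
  have h3 : (A • (volume : Measure (Euc N)).restrict D) univ = A * volume D := by simp
  rw [h3] at h2 ⊢
  refine (eLpNorm_le_interp_top (Lp.aestronglyMeasurable _) hq hqp).trans ?_
  set V := volume D
  calc _ ≤ (A * (F * V ^ (1 - 1 / q))) ^ (1 - q / p) * (A * V * F) ^ (q / p) := by
        gcongr
    _ = _ := by
        have e1 : 0 ≤ 1 - q / p := by linarith
        have e2 : 0 ≤ q / p := by positivity
        have e3 : (A * (F * V ^ (1 - 1 / q))) ^ (1 - q / p) * (A * V * F) ^ (q / p)
          = (A ^ (1 - q / p) * A ^ (q / p)) * ((F ^ (1 - q / p) * F ^ (q / p))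
            * ((V ^ (1 - 1 / q)) ^ (1 - q / p) * V ^ (q / p))) := by
          rw [ENNReal.mul_rpow_of_nonneg _ _ e1, ENNReal.mul_rpow_of_nonneg _ _ e1,
            ENNReal.mul_rpow_of_nonneg _ _ e2, ENNReal.mul_rpow_of_nonneg _ _ e2]
          ring
        rw [e3, ← ENNReal.rpow_add_of_nonneg _ _ e1 e2, ← ENNReal.rpow_add_of_nonneg _ _ e1 e2,
          ← ENNReal.rpow_mul, ← ENNReal.rpow_add _ _ hD0 hD, sub_add_cancel, ENNReal.rpow_one,
          ENNReal.rpow_one]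
        have e4 : (1 - 1 / q) * (1 - q / p) + q / p = 1 + -(1 / q - 1 / p) := by
          field_simp
          ring
        rw [e4, ENNReal.rpow_add _ _ hD0 hD, ENNReal.rpow_one]
        ring

end NonlocalHeat

/-! ### Large jumps in annuli and the decay estimate for finite measures. -/

namespace NonlocalHeat

variable {N : ℕ}

/-- The closed annulus `r ≤ |z| ≤ 2r`. -/
def annulus (N : ℕ) (r : ℝ) : Set (Euc N) := {z | r ≤ ‖z‖ ∧ ‖z‖ ≤ 2 * r}

open scoped Pointwise in
theorem annulus_eq_smul {r : ℝ} (hr : 0 < r) : annulus N r = r • annulus N 1 := by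
  ext z
  rw [Set.mem_smul_set_iff_inv_smul_mem₀ hr.ne']
  simp only [annulus, mem_ofPred_eq, norm_smul, norm_inv, Real.norm_of_nonneg hr.le]
  rw [inv_mul_eq_div, le_div_iff₀ hr, div_le_iff₀ hr, one_mul, mul_one]

theorem volume_annulus_ne_top (r : ℝ) : volume (annulus N r) ≠ ∞ := by
  refine ((measure_mono fun z hz => ?_).trans_lt
    (measure_closedBall_lt_top (x := (0 : Euc N)) (r := 2 * r))).ne
  simpa using hz.2

theorem volume_annulus_one_pos (hN : 1 ≤ N) : 0 < volume.real (annulus N 1) := by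
  refine ENNReal.toReal_pos (ne_of_gt ?_) (volume_annulus_ne_top 1)
  have : Nonempty (Fin N) := ⟨⟨0, hN⟩⟩
  -- The ball of radius `1/2` about a point of norm `3/2` lies in the unit annulus.
  obtain ⟨v, hv⟩ := exists_norm_eq (Euc N) (by norm_num : (0 : ℝ) ≤ 3 / 2)
  refine (Metric.measure_ball_pos volume v (by norm_num : (0 : ℝ) < 1 / 2)).trans_le
    (measure_mono fun z hz => ?_)
  rw [Metric.mem_ball, dist_eq_norm] at hz
  have h1 := norm_sub_norm_le v z
  have h2 := norm_sub_norm_le z v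
  rw [norm_sub_rev] at h1
  constructor <;> linarith

theorem volume_annulus {r : ℝ} (hr : 0 < r) :
    volume (annulus N r) = ENNReal.ofReal (volume.real (annulus N 1) * r ^ (N : ℝ)) := by
  rw [annulus_eq_smul hr, Measure.addHaar_smul, finrank_euclideanSpace, Fintype.card_fin,
    abs_of_nonneg (by positivity), mul_comm, ENNReal.ofReal_mul measureReal_nonneg,
    ofReal_measureReal (volume_annulus_ne_top 1), Real.rpow_natCast]

theorem eLpNorm_semi_add_restrict_le {a : ℝ} {D : Set (Euc N)}
    [IsFiniteMeasure (ENNReal.ofReal a • (volume : Measure (Euc N)).restrict D)]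
    (hD0 : volume D ≠ 0) (hD : volume D ≠ ∞) (ν' : Measure (Euc N)) [IsFiniteMeasure ν']
    {t : ℝ} (ht : 0 ≤ t) (f : EucL2 N) {q p : ℝ} (hq : 1 ≤ q) (hqp : q < p) :
    eLpNorm (semi (ENNReal.ofReal a • (volume : Measure (Euc N)).restrict D + ν') t f)
      (ENNReal.ofReal p) volume
      ≤ ENNReal.ofReal (Real.exp
          (-(t * (ENNReal.ofReal a • (volume : Measure (Euc N)).restrict D).real univ)))
          * eLpNorm f (ENNReal.ofReal p) volume
        + volume D ^ (-(1 / q - 1 / p)) * eLpNorm f (ENNReal.ofReal q) volume := by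
  have hp1 : (1 : ℝ≥0∞) ≤ ENNReal.ofReal p := by
    simpa using ENNReal.ofReal_le_ofReal (hq.trans hqp.le)
  have hq1 : (1 : ℝ≥0∞) ≤ ENNReal.ofReal q := by simpa using ENNReal.ofReal_le_ofReal hq
  rw [semi_add_measure, mul_apply_eq_comp]
  refine (eLpNorm_semi_le_of_avg _ ht _ hp1
    (eLpNorm_avg_restrict_le hD0 hD (semi ν' t f) hq hqp)).trans ?_
  gcongr
  · exact eLpNorm_semi_le ν' ht f hp1
  · exact eLpNorm_semi_le ν' ht f hq1

/-- Makes the constant uniform in `q`, where `θ = 1/q - 1/p`. -/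
theorem rpow_neg_le_max {x θ : ℝ} (hx : 0 < x) (h0 : 0 ≤ θ) (h1 : θ ≤ 1) :
    x ^ (-θ) ≤ max 1 x⁻¹ := by
  rcases le_total 1 x with h | h
  · exact (Real.rpow_le_one_of_one_le_of_nonpos h (by linarith)).trans (le_max_left _ _)
  · rw [← Real.rpow_neg_one x]
    exact (Real.rpow_le_rpow_of_exponent_ge hx h (by linarith)).trans (le_max_right _ _)

/-- The measure `ν` dominates the jumps of size in `[r, 2r]` of the `α`-stable process,
for all `r ≥ R`. -/
def DominatesStable (α c R : ℝ) (ν : Measure (Euc N)) : Prop :=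
  ∀ r : ℝ, R ≤ r → ∃ ν' : Measure (Euc N),
    ν = ENNReal.ofReal (c * (2 * r) ^ (-(N : ℝ) - α)) • volume.restrict (annulus N r) + ν'

theorem exists_one_step_bound (hN : 1 ≤ N) {α c R K : ℝ} (hα : 0 < α) (hc : 0 < c) (hR : 0 < R)
    (hK : 0 < K) :
    ∃ t₁ : ℝ, 0 < t₁ ∧ ∃ C : ℝ, 1 ≤ C ∧ ∀ (ν : Measure (Euc N)) [IsFiniteMeasure ν],
      DominatesStable α c R ν → ∀ t : ℝ, t₁ ≤ t → ∀ (f : EucL2 N) (q p : ℝ), 1 ≤ q → q < p →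
        eLpNorm (semi ν t f) (ENNReal.ofReal p) volume
          ≤ ENNReal.ofReal (Real.exp (-K)) * eLpNorm f (ENNReal.ofReal p) volume
            + ENNReal.ofReal (C * t ^ (-((N : ℝ) / α * (1 / q - 1 / p))))
              * eLpNorm f (ENNReal.ofReal q) volume := by
  have hκ := volume_annulus_one_pos hN
  set κ := volume.real (annulus N 1) with hκdef
  set c' := c * κ * 2 ^ (-(N : ℝ) - α) with hc'
  have hc'0 : 0 < c' := by positivity
  have hx0 : 0 < κ * (c' / K) ^ ((N : ℝ) / α) := by positivity
  -- The annulus at radius `r` carries mass `c' r ^ (-α)`. Requiring `t` times this mass to equal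
  -- `K` gives `r ^ α = c' t / K`, and the first witness is the time at which `r` reaches `R`.
  refine ⟨K * R ^ α / c', by positivity, max 1 (κ * (c' / K) ^ ((N : ℝ) / α))⁻¹, le_max_left _ _,
    ?_⟩
  intro ν _ hν t ht f q p hq hqp
  have ht0 : 0 < t := lt_of_lt_of_le (by positivity) ht
  set r := (c' * t / K) ^ (1 / α) with hr
  have hr0 : 0 < r := by positivity
  have hrα : r ^ α = c' * t / K := by
    rw [hr, ← Real.rpow_mul (by positivity), one_div_mul_cancel hα.ne', Real.rpow_one]
  have hRr : R ≤ r := by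
    rw [← Real.rpow_le_rpow_iff hR.le hr0.le hα, hrα, le_div_iff₀ hK]
    rw [div_le_iff₀ hc'0] at ht
    linarith
  obtain ⟨ν', rfl⟩ := hν r hRr
  have : IsFiniteMeasure ν' := isFiniteMeasure_of_le
    (ENNReal.ofReal (c * (2 * r) ^ (-(N : ℝ) - α)) • (volume : Measure (Euc N)).restrict
      (annulus N r) + ν') (Measure.le_add_left le_rfl)
  have := isFiniteMeasure_smul_restrict (c * (2 * r) ^ (-(N : ℝ) - α)) (annulus N r)
    (volume_annulus_ne_top r)
  have hV := volume_annulus (N := N) hr0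
  have hV0 : volume (annulus N r) ≠ 0 := by
    rw [hV, ← hκdef]
    exact (ENNReal.ofReal_pos.2 (by positivity)).ne'
  refine (eLpNorm_semi_add_restrict_le hV0 (volume_annulus_ne_top r) ν' ht0.le f hq hqp).trans ?_
  have hmass : t * (ENNReal.ofReal (c * (2 * r) ^ (-(N : ℝ) - α))
      • (volume : Measure (Euc N)).restrict (annulus N r)).real univ = K := by
    rw [measureReal_ennreal_smul_apply, ENNReal.toReal_ofReal (by positivity), measureReal_restrict_apply_univ, Measure.real, hV,
      ENNReal.toReal_ofReal (by positivity), ← hκdef]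
    have h1 : (2 * r) ^ (-(N : ℝ) - α) * r ^ (N : ℝ) = 2 ^ (-(N : ℝ) - α) * (r ^ α)⁻¹ := by
      rw [Real.mul_rpow (by norm_num) hr0.le, mul_assoc, ← Real.rpow_add hr0, ← Real.rpow_neg hr0.le]
      congr 2
      ring
    calc _ = t * (c * κ * ((2 * r) ^ (-(N : ℝ) - α) * r ^ (N : ℝ))) := by ring
      _ = t * (c' * (r ^ α)⁻¹) := by rw [h1, hc']; ring
      _ = K := by rw [hrα]; field_simp
  rw [hmass]
  gcongr
  have hp : 0 < p := by linarith
  set θ := 1 / q - 1 / p with hθ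
  have hθ0 : 0 ≤ θ := sub_nonneg.2 (one_div_le_one_div_of_le (by linarith) hqp.le)
  have hθ1 : θ ≤ 1 := by
    have : 1 / q ≤ 1 := (div_le_one (by linarith)).2 hq
    have : 0 < 1 / p := by positivity
    linarith
  rw [hV, ENNReal.ofReal_rpow_of_pos (by positivity)]
  refine ENNReal.ofReal_le_ofReal ?_
  have h2 : κ * r ^ (N : ℝ) = κ * (c' / K) ^ ((N : ℝ) / α) * t ^ ((N : ℝ) / α) := by
    rw [hr, ← Real.rpow_mul (by positivity), mul_assoc κ, ← Real.mul_rpow (by positivity) ht0.le]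
    congr 2
    · ring
    · ring
  rw [← hκdef, h2, Real.mul_rpow hx0.le (by positivity), ← Real.rpow_mul ht0.le]
  have h3 : (N : ℝ) / α * -θ = -((N : ℝ) / α * θ) := by ring
  rw [h3]
  gcongr
  exact rpow_neg_le_max hx0 hθ0 hθ1

/-- Induction over time doublings. With `m = N/α + 1` and `K = m log 2`, each doubling multiplies
the `L^p` coefficient by `2 ^ (-m)`. The constants serve all `ν` and all `q` at once, as the
truncation limit and the final theorem require. -/
theorem exists_decay_bound (hN : 1 ≤ N) {α c R p : ℝ} (hα : 0 < α) (hc : 0 < c) (hR : 0 < R) :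
    ∃ t₁ : ℝ, 0 < t₁ ∧ ∃ B : ℝ, 0 < B ∧ ∀ (ν : Measure (Euc N)) [IsFiniteMeasure ν],
      DominatesStable α c R ν → ∀ t : ℝ, t₁ ≤ t → ∀ (f : EucL2 N) (q : ℝ), 1 ≤ q → q < p →
        eLpNorm (semi ν t f) (ENNReal.ofReal p) volume
          ≤ ENNReal.ofReal ((2 * t₁ / t) ^ ((N : ℝ) / α + 1)) * eLpNorm f (ENNReal.ofReal p) volume
            + ENNReal.ofReal (B * t ^ (-((N : ℝ) / α * (1 / q - 1 / p))))
              * eLpNorm f (ENNReal.ofReal q) volume := by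
  set m := (N : ℝ) / α + 1 with hm
  have hm0 : 0 < m := by positivity
  obtain ⟨t₁, ht₁, C, hC, hstep⟩ := exists_one_step_bound (K := m * Real.log 2) hN hα hc hR
    (mul_pos hm0 (Real.log_pos (by norm_num)))
  have hexp : Real.exp (-(m * Real.log 2)) = 2 ^ (-m) := by
    rw [Real.rpow_def_of_pos (by norm_num)]
    ring_nf
  rw [hexp] at hstep
  refine ⟨t₁, ht₁, 2 ^ m * C, by positivity, ?_⟩
  intro ν _ hν
  suffices H : ∀ n : ℕ, ∀ t : ℝ, t₁ ≤ t → t ≤ t₁ * 2 ^ (n + 1) → ∀ (f : EucL2 N) (q : ℝ), 1 ≤ q → q < p →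
        eLpNorm (semi ν t f) (ENNReal.ofReal p) volume
          ≤ ENNReal.ofReal ((2 * t₁ / t) ^ m) * eLpNorm f (ENNReal.ofReal p) volume
            + ENNReal.ofReal (2 ^ m * C * t ^ (-((N : ℝ) / α * (1 / q - 1 / p))))
              * eLpNorm f (ENNReal.ofReal q) volume by
    intro t ht
    obtain ⟨n, hn⟩ := pow_unbounded_of_one_lt (t / t₁) (by norm_num : (1 : ℝ) < 2)
    refine H n t ht ?_
    rw [div_lt_iff₀ ht₁] at hn
    have : (2 : ℝ) ^ n ≤ 2 ^ (n + 1) := pow_le_pow_right₀ (by norm_num) (by omega)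
    nlinarith
  -- Up to time `2 t₁` the `L^p` coefficient is at least one, and contraction suffices.
  have base : ∀ t : ℝ, t₁ ≤ t → t ≤ 2 * t₁ → ∀ (f : EucL2 N) (q : ℝ), 1 ≤ q → q < p →
        eLpNorm (semi ν t f) (ENNReal.ofReal p) volume
          ≤ ENNReal.ofReal ((2 * t₁ / t) ^ m) * eLpNorm f (ENNReal.ofReal p) volume
            + ENNReal.ofReal (2 ^ m * C * t ^ (-((N : ℝ) / α * (1 / q - 1 / p))))
              * eLpNorm f (ENNReal.ofReal q) volume := by
    intro t ht ht2 f q hq hqp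
    have ht0 : 0 < t := ht₁.trans_le ht
    have hp1 : (1 : ℝ≥0∞) ≤ ENNReal.ofReal p := by
      simpa using ENNReal.ofReal_le_ofReal (hq.trans hqp.le)
    refine (eLpNorm_semi_le ν ht0.le f hp1).trans (le_add_right ?_)
    refine le_mul_of_one_le_left' ?_
    rw [← ENNReal.ofReal_one]
    exact ENNReal.ofReal_le_ofReal (Real.one_le_rpow ((one_le_div ht0).2 ht2) hm0.le)
  intro n
  induction n with
  | zero =>
    intro t ht ht2
    rw [zero_add, pow_one] at ht2
    exact base t ht (by linarith)
  | succ n ih =>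
    intro t ht ht2 f q hq hqp
    rcases le_total t (2 * t₁) with h | h
    · exact base t ht h f q hq hqp
    have ht0 : 0 < t := ht₁.trans_le ht
    have hs1 : t₁ ≤ t / 2 := by linarith
    have hs2 : t / 2 ≤ t₁ * 2 ^ (n + 1) := by
      rw [pow_succ, ← mul_assoc] at ht2
      linarith
    have hq1 : (1 : ℝ≥0∞) ≤ ENNReal.ofReal q := by simpa using ENNReal.ofReal_le_ofReal hq
    set σ := (N : ℝ) / α * (1 / q - 1 / p) with hσ
    -- The spare unit in `m` gives `2 * 2 ^ σ ≤ 2 ^ m`, so the two `L^q` contributions at time `t /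
    -- 2` together still fit under `2 ^ m * C * t ^ (-σ)`.
    have hσm : σ ≤ m - 1 := by
      have h1 : 1 / q ≤ 1 := (div_le_one (by linarith)).2 hq
      have h2 : 0 < 1 / p := by
        have : 0 < p := by linarith
        positivity
      have h3 : 0 ≤ (N : ℝ) / α := by positivity
      rw [hσ, hm]
      nlinarith
    have hsplit : semi ν t f = semi ν (t / 2) (semi ν (t / 2) f) := by
      rw [← mul_apply_eq_comp, ← semi_add, add_halves]
    rw [hsplit]
    refine (hstep ν hν (t / 2) hs1 _ q p hq hqp).trans ?_
    calc _ ≤ ENNReal.ofReal (2 ^ (-m)) *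
          (ENNReal.ofReal ((2 * t₁ / (t / 2)) ^ m) * eLpNorm f (ENNReal.ofReal p) volume
            + ENNReal.ofReal (2 ^ m * C * (t / 2) ^ (-σ)) * eLpNorm f (ENNReal.ofReal q) volume)
          + ENNReal.ofReal (C * (t / 2) ^ (-σ)) * eLpNorm f (ENNReal.ofReal q) volume := by
          gcongr
          · exact ih (t / 2) hs1 hs2 f q hq hqp
          · exact eLpNorm_semi_le ν (by positivity) f hq1
      _ = ENNReal.ofReal (2 ^ (-m) * (2 * t₁ / (t / 2)) ^ m) * eLpNorm f (ENNReal.ofReal p) volume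
          + ENNReal.ofReal (2 ^ (-m) * (2 ^ m * C * (t / 2) ^ (-σ)) + C * (t / 2) ^ (-σ))
            * eLpNorm f (ENNReal.ofReal q) volume := by
          rw [ENNReal.ofReal_add (by positivity) (by positivity),
            ENNReal.ofReal_mul (p := 2 ^ (-m)) (q := (2 * t₁ / (t / 2)) ^ m) (by positivity),
            ENNReal.ofReal_mul (p := 2 ^ (-m)) (q := 2 ^ m * C * (t / 2) ^ (-σ)) (by positivity)]
          ring
      _ ≤ _ := by
          gcongr
          · rw [show 2 * t₁ / (t / 2) = 2 * (2 * t₁ / t) by field_simp,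
              Real.mul_rpow (by norm_num) (by positivity), ← mul_assoc,
              ← Real.rpow_add (by norm_num), neg_add_cancel, Real.rpow_zero, one_mul]
          · have h1 : (t / 2) ^ (-σ) = 2 ^ σ * t ^ (-σ) := by
              rw [div_eq_mul_inv, Real.mul_rpow ht0.le (by norm_num), Real.inv_rpow (by norm_num),
                Real.rpow_neg (by norm_num : (0 : ℝ) ≤ 2), inv_inv, mul_comm]
            have h2 : (2 : ℝ) ^ (-m) * 2 ^ m = 1 := by
              rw [← Real.rpow_add (by norm_num), neg_add_cancel, Real.rpow_zero]
            have h3 : 2 * (2 : ℝ) ^ σ ≤ 2 ^ m := by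
              calc 2 * (2 : ℝ) ^ σ = 2 ^ (1 + σ) := by
                    rw [Real.rpow_add (by norm_num), Real.rpow_one]
                _ ≤ _ := Real.rpow_le_rpow_of_exponent_le (by norm_num) (by linarith)
            calc _ = (2 ^ (-m) * 2 ^ m + 1) * C * (t / 2) ^ (-σ) := by ring
              _ = 2 * 2 ^ σ * (C * t ^ (-σ)) := by rw [h1, h2]; ring
              _ ≤ 2 ^ m * (C * t ^ (-σ)) := by gcongr
              _ = _ := by ring

end NonlocalHeat

/-! ### The generator on smooth functions and truncation of the small jumps. -/

namespace NonlocalHeat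

variable {N : ℕ}

/-- First-order Taylor expansion with a Lipschitz derivative; the linear terms at `z` and `-z`
cancel. -/
theorem norm_second_difference_le {g : Euc N → ℝ} (hg : HasCompactSupport g)
    (hg2 : ContDiff ℝ (⊤ : ℕ∞) g) :
    ∃ M : ℝ, 0 ≤ M ∧ ∀ x z, |g x - 1 / 2 * (g (x - z) + g (x + z))| ≤ M * ‖z‖ ^ 2 := by
  have hd : ContDiff ℝ 1 (fderiv ℝ g) :=
    (contDiff_infty.1 hg2 2).fderiv_right (by norm_num [one_add_one_eq_two])
  obtain ⟨M, hM⟩ := ContDiff.lipschitzWith_of_hasCompactSupport (hg.fderiv ℝ) hd one_ne_zero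
  have key : ∀ x z, ‖g (x + z) - g x - fderiv ℝ g x z‖ ≤ M * ‖z‖ * ‖z‖ := by
    intro x z
    have h := Convex.norm_image_sub_le_of_norm_fderiv_le' (𝕜 := ℝ) (f := g) (C := M * ‖z‖)
      (s := Metric.closedBall x ‖z‖) (x := x) (y := x + z) (φ := fderiv ℝ g x)
      (fun w _ => (hg2.differentiable (by simp)) w)
      (fun w hw => by
        refine (hM.norm_sub_le w x).trans ?_
        rw [Metric.mem_closedBall, dist_eq_norm] at hw
        gcongr) (convex_closedBall _ _) (Metric.mem_closedBall_self (norm_nonneg _)) (by simp)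
    simpa using h
  refine ⟨M, M.2, fun x z => ?_⟩
  have h1 := key x z
  have h2 := key x (-z)
  rw [norm_neg, map_neg, ← sub_eq_add_neg, sub_neg_eq_add] at h2
  rw [Real.norm_eq_abs, abs_le] at h1 h2
  rw [abs_le]
  constructor <;> nlinarith

/-- The classes of smooth compactly supported functions in `L²`. -/
def IsTest (f : EucL2 N) : Prop :=
  ∃ g : Euc N → ℝ, f =ᵐ[volume] g ∧ HasCompactSupport g ∧ ContDiff ℝ (⊤ : ℕ∞) g

theorem dense_isTest : Dense {f : EucL2 N | IsTest f} :=
  Lp.dense_hasCompactSupport_contDiff (by norm_num)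

theorem coeFn_sub_symShift {f : EucL2 N} {g : Euc N → ℝ} (hfg : f =ᵐ[volume] g) (z : Euc N) :
    (f - symShift z f : EucL2 N) =ᵐ[volume]
      fun x => g x - 1 / 2 * (g (x - z) + g (x + z)) := by
  filter_upwards [Lp.coeFn_sub f (symShift z f), Lp.coeFn_smul (1 / 2 : ℝ) (shift z f + shift (-z) f),
    Lp.coeFn_add (shift z f) (shift (-z) f), coeFn_shift z f, coeFn_shift (-z) f, hfg,
    ae_eq_comp_sub hfg z, ae_eq_comp_sub hfg (-z)] with x h1 h2 h3 h4 h5 h6 h7 h8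
  rw [h1, Pi.sub_apply, symShift_apply, h2, Pi.smul_apply, h3, Pi.add_apply, h4, h5, h6, h7, h8,
    sub_neg_eq_add, smul_eq_mul]

/-- For `‖z‖ ≤ 1` the second difference is supported in a fixed ball and is of order `‖z‖²`;
otherwise contraction suffices. The right side is exactly what a Lévy measure integrates. -/
theorem IsTest.norm_sub_symShift_le {f : EucL2 N} (hf : IsTest f) :
    ∃ C : ℝ, 0 ≤ C ∧ ∀ z, ‖f - symShift z f‖ ≤ C * min (‖z‖ ^ 2) 1 := by
  obtain ⟨g, hfg, hg, hg2⟩ := hf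
  obtain ⟨M, hM0, hM⟩ := norm_second_difference_le hg hg2
  obtain ⟨ρ, hρ⟩ := hg.isCompact.isBounded.subset_closedBall (0 : Euc N)
  set K : Set (Euc N) := Metric.closedBall 0 (ρ + 1)
  have hK : MeasurableSet K := measurableSet_closedBall
  have hKv : volume K ≠ ∞ := measure_closedBall_lt_top.ne
  refine ⟨max (M * volume.real K ^ (1 / (2 : ℝ≥0∞).toReal)) (2 * ‖f‖), by positivity, fun z => ?_⟩
  rcases le_total ‖z‖ 1 with hz | hz
  · rw [min_eq_left (by nlinarith [norm_nonneg z])]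
    have h1 : ‖f - symShift z f‖ ≤ ‖indicatorConstLp 2 hK hKv (M * ‖z‖ ^ 2)‖ := by
      refine Lp.norm_le_norm_of_ae_le ?_
      filter_upwards [coeFn_sub_symShift hfg z,
        indicatorConstLp_coeFn (p := 2) (hs := hK) (hμs := hKv) (c := M * ‖z‖ ^ 2)] with x h1 h2
      rw [h1, h2]
      by_cases hx : x ∈ K
      · rw [indicator_of_mem hx]
        exact (hM x z).trans (le_abs_self _)
      · have hout : ∀ w : Euc N, ‖w‖ ≤ 1 → g (x + w) = 0 := by
          intro w hw
          refine image_eq_zero_of_notMem_tsupport fun hmem => hx ?_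
          have h3 := hρ hmem
          rw [mem_closedBall_zero_iff] at h3 ⊢
          have h4 := norm_sub_le (x + w) w
          rw [add_sub_cancel_right] at h4
          linarith
        have e0 := hout 0 (by simp)
        have e1 := hout z hz
        have e2 := hout (-z) (by simpa using hz)
        rw [add_zero] at e0
        rw [← sub_eq_add_neg] at e2
        simp [e0, e1, e2]
    rw [norm_indicatorConstLp (by norm_num) (by norm_num), Real.norm_of_nonneg (by positivity)] at h1
    calc _ ≤ _ := h1
      _ = M * volume.real K ^ (1 / (2 : ℝ≥0∞).toReal) * ‖z‖ ^ 2 := by ring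
      _ ≤ _ := by gcongr; exact le_max_left _ _
  · rw [min_eq_right (by nlinarith), mul_one]
    refine le_trans ?_ (le_max_right _ _)
    have := norm_sub_le f (symShift z f)
    linarith [norm_symShift_le z f]

/-- Differentiate `semi ν s (semi ν' (t - s) f)` in `s`: as everything commutes, the derivative is a
contraction applied to the difference of the generators at `f`. -/
theorem norm_semi_sub_le (ν ν' : Measure (Euc N)) [IsFiniteMeasure ν] [IsFiniteMeasure ν']
    {t : ℝ} (ht : 0 ≤ t) (f : EucL2 N) :
    ‖semi ν t f - semi ν' t f‖ ≤ t * ‖gen ν f - gen ν' f‖ := by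
  have hd : ∀ s : ℝ, HasDerivAt (fun s => semi ν s (semi ν' (t - s) f))
      (semi ν s (semi ν' (t - s) (gen ν' f - gen ν f))) s := by
    intro s
    have h1 : HasDerivAt (fun s => semi ν' (t - s)) (semi ν' (t - s) * gen ν') s := by
      have := (hasDerivAt_semi ν' (t - s)).scomp s ((hasDerivAt_id s).const_sub t)
      simpa [Function.comp_def] using this
    have h2 := ((hasDerivAt_semi ν s).mul h1).clm_apply (hasDerivAt_const s f)
    have hc : Commute (gen ν) (semi ν' (t - s)) := commute_of_commute_gen ν' (commute_gen ν ν') _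
    have e : (-(semi ν s * gen ν) * semi ν' (t - s) + semi ν s * (semi ν' (t - s) * gen ν')) f
        = semi ν s (semi ν' (t - s) (gen ν' f - gen ν f)) := by
      rw [neg_mul, mul_assoc, hc.eq]
      simp only [add_apply, neg_apply, mul_apply_eq_comp, map_sub]
      abel
    rw [map_zero, add_zero, e] at h2
    exact h2
  have h := norm_image_sub_le_of_norm_deriv_le_segment' (a := 0) (b := t)
    (fun s _ => (hd s).hasDerivWithinAt) (C := ‖gen ν' f - gen ν f‖)
    (fun s hs => (norm_semi_le ν hs.1 _).trans (norm_semi_le ν' (by linarith [hs.2]) _)) t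
    (right_mem_Icc.2 ht)
  simp only [sub_self, sub_zero, semi_zero, one_apply_eq_self] at h
  rw [norm_sub_rev (gen ν f), mul_comm]
  exact h

variable (J : Euc N → ℝ)

/-- The Lévy measure with density `J`. -/
def levyMeasure : Measure (Euc N) := volume.withDensity fun z => ENNReal.ofReal (J z)

/-- The region of jumps larger than `1 / (n + 1)`. -/
def farRegion (N n : ℕ) : Set (Euc N) := {z | 1 / ((n : ℝ) + 1) < ‖z‖}

/-- The Lévy measure without the jumps smaller than `1 / (n + 1)`. -/
def levyCut (n : ℕ) : Measure (Euc N) := (levyMeasure J).restrict (farRegion N n)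

/-- The generator of the Lévy process, meaningful on smooth functions. -/
def levyGen (f : EucL2 N) : EucL2 N := ∫ z, (f - symShift z f) ∂(levyMeasure J)

theorem measurableSet_farRegion (n : ℕ) : MeasurableSet (farRegion N n) :=
  (isOpen_lt continuous_const continuous_norm).measurableSet

theorem monotone_farRegion : Monotone (farRegion N) := by
  intro m n hmn z hz
  have h1 : 1 / ((m : ℝ) + 1) < ‖z‖ := hz
  refine lt_of_le_of_lt (b := 1 / ((m : ℝ) + 1)) ?_ h1
  gcongr

theorem iUnion_farRegion : ⋃ n, farRegion N n = {0}ᶜ := by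
  ext z
  simp only [mem_iUnion, farRegion, mem_ofPred_eq, mem_compl_iff, mem_singleton_iff]
  constructor
  · rintro ⟨n, hn⟩ rfl
    rw [norm_zero] at hn
    have : 0 < 1 / ((n : ℝ) + 1) := by positivity
    linarith
  · intro hz
    exact exists_nat_one_div_lt (norm_pos_iff.2 hz)

variable {J} (hJ : IsLevyKernel J)
include hJ

theorem measurable_ofReal_kernel : Measurable fun z => ENNReal.ofReal (J z) :=
  hJ.measurable.ennreal_ofReal

theorem integrable_levyMeasure_iff {F : Type*} [NormedAddCommGroup F] [NormedSpace ℝ F]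
    {g : Euc N → F} :
    Integrable g (levyMeasure J) ↔ Integrable (fun z => J z • g z) volume := by
  rw [levyMeasure, integrable_withDensity_iff_integrable_smul' (measurable_ofReal_kernel hJ)
    (by simp)]
  simp only [ENNReal.toReal_ofReal (hJ.nonneg _)]

theorem integral_levyMeasure {F : Type*} [NormedAddCommGroup F] [NormedSpace ℝ F]
    (g : Euc N → F) : ∫ z, g z ∂(levyMeasure J) = ∫ z, J z • g z := by
  rw [levyMeasure, integral_withDensity_eq_integral_toReal_smul (measurable_ofReal_kernel hJ)
    (by simp)]
  simp only [ENNReal.toReal_ofReal (hJ.nonneg _)]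

theorem integrable_min_levyMeasure :
    Integrable (fun z : Euc N => min (‖z‖ ^ 2) 1) (levyMeasure J) :=
  (integrable_levyMeasure_iff hJ).2 hJ.integrable

theorem isFiniteMeasure_levyCut (n : ℕ) : IsFiniteMeasure (levyCut J n) := by
  constructor
  rw [levyCut, Measure.restrict_apply_univ]
  set ε : ℝ := min ((1 / ((n : ℝ) + 1)) ^ 2) 1
  have hε : 0 < ε := lt_min (by positivity) one_pos
  refine (measure_mono fun z hz => ?_).trans_lt
    ((integrable_min_levyMeasure hJ).measure_ge_lt_top hε)
  have h1 : 1 / ((n : ℝ) + 1) < ‖z‖ := hz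
  have h2 : (1 / ((n : ℝ) + 1)) ^ 2 ≤ ‖z‖ ^ 2 := by gcongr
  exact min_le_min h2 le_rfl

theorem integrable_sub_symShift {f : EucL2 N} (hf : IsTest f) :
    Integrable (fun z => f - symShift z f) (levyMeasure J) := by
  obtain ⟨C, hC0, hC⟩ := hf.norm_sub_symShift_le
  refine ((integrable_min_levyMeasure hJ).const_mul C).mono'
    (continuous_const.sub (continuous_symShift f)).aestronglyMeasurable
    (Eventually.of_forall hC)

omit hJ in
theorem ae_ne_zero_levyMeasure (hN : 1 ≤ N) : ∀ᵐ z ∂(levyMeasure J), z ∈ ({0}ᶜ : Set (Euc N)) := by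
  have : Nonempty (Fin N) := ⟨⟨0, hN⟩⟩
  refine (withDensity_absolutelyContinuous volume _).ae_le ?_
  have h0 : (volume : Measure (Euc N)) {0} = 0 := measure_singleton 0
  exact compl_mem_ae_iff.2 h0

/-- The truncated generators converge on smooth functions. -/
theorem tendsto_gen_levyCut (hN : 1 ≤ N) {f : EucL2 N} (hf : IsTest f) :
    Tendsto (fun n => (haveI := isFiniteMeasure_levyCut hJ n; gen (levyCut J n)) f) atTop
      (𝓝 (levyGen J f)) := by
  have h := tendsto_setIntegral_of_monotone (μ := levyMeasure J) (f := fun z => f - symShift z f)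
    measurableSet_farRegion monotone_farRegion (integrable_sub_symShift hJ hf).integrableOn
  rw [iUnion_farRegion, Measure.restrict_eq_self_of_ae_mem (ae_ne_zero_levyMeasure hN)] at h
  refine h.congr fun n => ?_
  have := isFiniteMeasure_levyCut hJ n
  rw [gen_eq_integral]
  rfl

/-- As `R ≥ 2`, the annuli avoid the removed jumps, which have size at most one. The domination is
therefore uniform in `n`. -/
theorem dominatesStable_levyCut {α c R : ℝ} (hc : 0 < c) (hα : 0 < α) (hR : 2 ≤ R)
    (hlow : ∀ z : Euc N, R ≤ ‖z‖ → c * ‖z‖ ^ (-(N : ℝ) - α) ≤ J z) (n : ℕ) :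
    DominatesStable α c R (levyCut J n) := by
  intro r hr
  set a := c * (2 * r) ^ (-(N : ℝ) - α)
  have := isFiniteMeasure_smul_restrict a (annulus N r) (volume_annulus_ne_top r)
  have hle : ENNReal.ofReal a • (volume : Measure (Euc N)).restrict (annulus N r) ≤ levyCut J n := by
    have hsub : annulus N r ⊆ farRegion N n := by
      intro z hz
      have h1 : 1 / ((n : ℝ) + 1) ≤ 1 := (div_le_one (by positivity)).2 (by linarith [n.cast_nonneg (α := ℝ)])
      have h2 : r ≤ ‖z‖ := hz.1
      exact lt_of_le_of_lt h1 (by linarith)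
    refine Measure.le_iff.2 fun s hs => ?_
    rw [levyCut, Measure.restrict_apply hs, levyMeasure,
      withDensity_apply _ (hs.inter (measurableSet_farRegion n)), Measure.smul_apply,
      Measure.restrict_apply hs, smul_eq_mul, ← setLIntegral_const]
    refine le_trans ?_ (lintegral_mono_set (inter_subset_inter_right s hsub))
    refine setLIntegral_mono (measurable_ofReal_kernel hJ) fun z hz => ENNReal.ofReal_le_ofReal ?_
    have hz1 : r ≤ ‖z‖ := hz.2.1
    have hz2 : ‖z‖ ≤ 2 * r := hz.2.2
    refine le_trans ?_ (hlow z (hr.trans hz1))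
    refine mul_le_mul_of_nonneg_left ?_ hc.le
    exact Real.rpow_le_rpow_of_nonpos (by linarith) hz2
      (by linarith [N.cast_nonneg (α := ℝ)])
  refine ⟨levyCut J n - ENNReal.ofReal a • (volume : Measure (Euc N)).restrict (annulus N r), ?_⟩
  rw [add_comm, Measure.sub_add_cancel_of_le hle]

end NonlocalHeat

/-! ### The limit semigroup. -/

namespace NonlocalHeat

variable {N : ℕ} {J : Euc N → ℝ}

/-- The generator of the process without the jumps smaller than `1 / (n + 1)`. -/
def cutGen (hJ : IsLevyKernel J) (n : ℕ) : EucL2 N →L[ℝ] EucL2 N :=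
  haveI := isFiniteMeasure_levyCut hJ n
  gen (levyCut J n)

/-- The semigroup of the process without the jumps smaller than `1 / (n + 1)`. -/
def cutSemi (hJ : IsLevyKernel J) (n : ℕ) (t : ℝ) : EucL2 N →L[ℝ] EucL2 N :=
  haveI := isFiniteMeasure_levyCut hJ n
  semi (levyCut J n) t

/-- The semigroup of the Lévy process with kernel `J`. -/
def limSemi (hJ : IsLevyKernel J) (t : ℝ) (f : EucL2 N) : EucL2 N :=
  limUnder atTop fun n => cutSemi hJ n t f

variable (hJ : IsLevyKernel J)

theorem norm_cutSemi_le (n : ℕ) {t : ℝ} (ht : 0 ≤ t) (f : EucL2 N) :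
    ‖cutSemi hJ n t f‖ ≤ ‖f‖ :=
  haveI := isFiniteMeasure_levyCut hJ n
  norm_semi_le (levyCut J n) ht f

theorem norm_cutSemi_sub_le (m n : ℕ) {t : ℝ} (ht : 0 ≤ t) (f : EucL2 N) :
    ‖cutSemi hJ m t f - cutSemi hJ n t f‖ ≤ t * ‖cutGen hJ m f - cutGen hJ n f‖ :=
  haveI := isFiniteMeasure_levyCut hJ n
  haveI := isFiniteMeasure_levyCut hJ m
  norm_semi_sub_le (levyCut J m) (levyCut J n) ht f

theorem hasDerivAt_cutSemi (n : ℕ) (t : ℝ) :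
    HasDerivAt (cutSemi hJ n) (-(cutSemi hJ n t * cutGen hJ n)) t :=
  haveI := isFiniteMeasure_levyCut hJ n
  hasDerivAt_semi (levyCut J n) t

theorem inner_cutSemi_left (n : ℕ) (t : ℝ) (f g : EucL2 N) :
    inner ℝ (cutSemi hJ n t f) g = inner ℝ f (cutSemi hJ n t g) :=
  haveI := isFiniteMeasure_levyCut hJ n
  inner_semi_left (levyCut J n) t f g

theorem cutSemi_zero (n : ℕ) : cutSemi hJ n 0 = 1 :=
  haveI := isFiniteMeasure_levyCut hJ n
  semi_zero (levyCut J n)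

theorem tendsto_cutGen (hN : 1 ≤ N) {f : EucL2 N} (hf : IsTest f) :
    Tendsto (fun n => cutGen hJ n f) atTop (𝓝 (levyGen J f)) :=
  tendsto_gen_levyCut hJ hN hf

/-- Approximate `f` by a test function `g`: the error is controlled by contraction, and on `g` the
truncated generators are Cauchy. -/
theorem uniformCauchySeqOn_cutSemi (hN : 1 ≤ N) (f : EucL2 N) (T : ℝ) :
    UniformCauchySeqOn (fun n t => cutSemi hJ n t f) atTop (Icc 0 T) := by
  rw [Metric.uniformCauchySeqOn_iff]
  intro ε hε
  obtain ⟨g, hg, hfg⟩ := Metric.mem_closure_iff.1 (dense_isTest (N := N) f) (ε / 4) (by positivity)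
  rw [dist_eq_norm] at hfg
  obtain ⟨n₀, hn₀⟩ := Metric.cauchySeq_iff.1 (tendsto_cutGen hJ hN hg).cauchySeq
    (ε / (2 * (|T| + 1))) (by positivity)
  refine ⟨n₀, fun m hm n hn t ht => ?_⟩
  have h1 := hn₀ m hm n hn
  rw [dist_eq_norm] at h1 ⊢
  have hT : t ≤ |T| + 1 := by linarith [ht.2, le_abs_self T]
  have e : cutSemi hJ m t f - cutSemi hJ n t f = cutSemi hJ m t (f - g)
      + (cutSemi hJ m t g - cutSemi hJ n t g) - cutSemi hJ n t (f - g) := by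
    simp only [map_sub]
    abel
  have h2 : t * ‖cutGen hJ m g - cutGen hJ n g‖ ≤ ε / 2 := by
    calc _ ≤ (|T| + 1) * (ε / (2 * (|T| + 1))) := by gcongr
      _ = ε / 2 := by field_simp
  rw [e]
  have h3 := norm_sub_le (cutSemi hJ m t (f - g)
      + (cutSemi hJ m t g - cutSemi hJ n t g)) (cutSemi hJ n t (f - g))
  have h4 := norm_add_le (cutSemi hJ m t (f - g)) (cutSemi hJ m t g - cutSemi hJ n t g)
  have h5 := norm_cutSemi_le hJ m ht.1 (f - g)
  have h6 := norm_cutSemi_le hJ n ht.1 (f - g)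
  have h7 := norm_cutSemi_sub_le hJ m n ht.1 g
  linarith

theorem tendsto_cutSemi (hN : 1 ≤ N) (f : EucL2 N) {t : ℝ} (ht : 0 ≤ t) :
    Tendsto (fun n => cutSemi hJ n t f) atTop (𝓝 (limSemi hJ t f)) := by
  have h : CauchySeq fun n => cutSemi hJ n t f :=
    (uniformCauchySeqOn_cutSemi hJ hN f t).cauchySeq ⟨ht, le_rfl⟩
  exact h.tendsto_limUnder

theorem continuousOn_limSemi (hN : 1 ≤ N) (f : EucL2 N) :
    ContinuousOn (fun t => limSemi hJ t f) (Ici 0) := by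
  have h : ∀ T, ContinuousOn (fun t => limSemi hJ t f) (Icc 0 T) := fun T =>
    ((uniformCauchySeqOn_cutSemi hJ hN f T).tendstoUniformlyOn_of_tendsto
      fun t ht => tendsto_cutSemi hJ hN f ht.1).continuousOn
      (Eventually.of_forall fun n => by
        have hc : Continuous (cutSemi hJ n) :=
          continuous_iff_continuousAt.2 fun t => (hasDerivAt_cutSemi hJ n t).continuousAt
        exact (hc.clm_apply continuous_const).continuousOn).frequently
  intro t ht
  refine ((h (t + 1)) t ⟨ht, by linarith⟩).mono_of_mem_nhdsWithin ?_
  filter_upwards [self_mem_nhdsWithin, mem_nhdsWithin_of_mem_nhds (Iio_mem_nhds (lt_add_one t))]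
    with s h1 h2 using ⟨h1, le_of_lt h2⟩

theorem limSemi_zero (hN : 1 ≤ N) (f : EucL2 N) : limSemi hJ 0 f = f := by
  refine tendsto_nhds_unique (tendsto_cutSemi hJ hN f le_rfl) ?_
  simp only [cutSemi_zero, one_apply_eq_self]
  exact tendsto_const_nhds

theorem exists_limSemi_decay_bound (hN : 1 ≤ N) {α c R p : ℝ} (hα : 0 < α) (hc : 0 < c)
    (hR : 2 ≤ R) (hlow : ∀ z : Euc N, R ≤ ‖z‖ → c * ‖z‖ ^ (-(N : ℝ) - α) ≤ J z) :
    ∃ t₁ : ℝ, 0 < t₁ ∧ ∃ B : ℝ, 0 < B ∧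
      ∀ t : ℝ, t₁ ≤ t → ∀ (f : EucL2 N) (q : ℝ), 1 ≤ q → q < p →
        eLpNorm (limSemi hJ t f) (ENNReal.ofReal p) volume
          ≤ ENNReal.ofReal ((2 * t₁ / t) ^ ((N : ℝ) / α + 1)) * eLpNorm f (ENNReal.ofReal p) volume
            + ENNReal.ofReal (B * t ^ (-((N : ℝ) / α * (1 / q - 1 / p))))
              * eLpNorm f (ENNReal.ofReal q) volume := by
  obtain ⟨t₁, ht₁, B, hB, h⟩ := exists_decay_bound (p := p) hN hα hc (show 0 < R by linarith)
  refine ⟨t₁, ht₁, B, hB, fun t ht f q hq hqp => ?_⟩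
  refine (isClosed_setOf_eLpNorm_le (ENNReal.ofReal p) _).mem_of_tendsto
    (tendsto_cutSemi hJ hN f (ht₁.le.trans ht)) (Eventually.of_forall fun n => ?_)
  have := isFiniteMeasure_levyCut hJ n
  exact h (levyCut J n) (dominatesStable_levyCut hJ hc hα hR hlow n) t ht f q hq hqp

end NonlocalHeat

/-! ### The Dirichlet form and the generator. -/

namespace NonlocalHeat

variable {N : ℕ} {J : Euc N → ℝ}

theorem coeFn_sub_shift_neg {U : EucL2 N} {u : Euc N → ℝ} (hU : U =ᵐ[volume] u) (w : Euc N) :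
    (U - shift (-w) U : EucL2 N) =ᵐ[volume] fun x => u x - u (x + w) := by
  filter_upwards [Lp.coeFn_sub U (shift (-w) U), coeFn_shift (-w) U, hU, ae_eq_comp_sub hU (-w)]
    with x h1 h2 h3 h4
  rw [h1, Pi.sub_apply, h2, h3, h4, sub_neg_eq_add]

theorem symShift_neg (z : Euc N) (f : EucL2 N) : symShift (-z) f = symShift z f := by
  rw [symShift_apply, symShift_apply, neg_neg, add_comm]

theorem integral_diff_mul_diff {U V : EucL2 N} {u v : Euc N → ℝ} (hU : U =ᵐ[volume] u)
    (hV : V =ᵐ[volume] v) (w : Euc N) :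
    Integrable (fun x => (u x - u (x + w)) * (v x - v (x + w))) volume ∧
      ∫ x, (u x - u (x + w)) * (v x - v (x + w)) = 2 * inner ℝ U (V - symShift w V) := by
  have h : (fun x => inner ℝ ((U - shift (-w) U : EucL2 N) x) ((V - shift (-w) V : EucL2 N) x))
      =ᵐ[volume] fun x => (u x - u (x + w)) * (v x - v (x + w)) := by
    filter_upwards [coeFn_sub_shift_neg hU w, coeFn_sub_shift_neg hV w] with x h1 h2
    rw [h1, h2, real_inner_eq_re_inner, RCLike.inner_apply']
    simp
  refine ⟨(integrable_congr h).1 (L2.integrable_inner _ _), ?_⟩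
  rw [← integral_congr_ae h, ← L2.inner_def, inner_sub_shift_sub_shift, symShift_neg]

theorem measurePreserving_shear :
    MeasurePreserving (MeasurableEquiv.shearAddRight (Euc N))
      ((volume : Measure (Euc N)).prod volume) (volume.prod volume) :=
  measurePreserving_prod_add volume volume

/-- The integrand of the Dirichlet form in the variables `x` and `y - x`. -/
def formIntegrand (J u v : Euc N → ℝ) (w : Euc N × Euc N) : ℝ :=
  (u w.1 - u (w.1 + w.2)) * (v w.1 - v (w.1 + w.2)) * J w.2

variable (hJ : IsLevyKernel J)
include hJ

theorem formIntegrand_eq (u v : Euc N → ℝ) :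
    formIntegrand J u v = (fun z : Euc N × Euc N =>
      (u z.1 - u z.2) * (v z.1 - v z.2) * J (z.1 - z.2)) ∘ MeasurableEquiv.shearAddRight (Euc N) := by
  funext w
  change _ = (u w.1 - u (w.1 + w.2)) * (v w.1 - v (w.1 + w.2)) * J (w.1 - (w.1 + w.2))
  rw [hJ.radial (w.1 - (w.1 + w.2)) w.2 (by simp)]
  rfl

theorem dirichletForm_eq_integral_formIntegrand (u v : Euc N → ℝ) :
    dirichletForm J u v
      = 1 / 2 * ∫ w, formIntegrand J u v w ∂((volume : Measure (Euc N)).prod volume) := by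
  rw [dirichletForm, formIntegrand_eq hJ]
  congr 1
  exact (measurePreserving_shear.integral_comp (MeasurableEquiv.measurableEmbedding _) _).symm

theorem aestronglyMeasurable_energy {u v : Euc N → ℝ} (hu : AEStronglyMeasurable u volume)
    (hv : AEStronglyMeasurable v volume) :
    AEStronglyMeasurable (fun z : Euc N × Euc N =>
      (u z.1 - u z.2) * (v z.1 - v z.2) * J (z.1 - z.2)) (volume.prod volume) :=
  ((hu.comp_fst.sub hu.comp_snd).mul (hv.comp_fst.sub hv.comp_snd)).mul
    (hJ.measurable.comp (measurable_fst.sub measurable_snd)).aestronglyMeasurable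

theorem aestronglyMeasurable_formIntegrand {u v : Euc N → ℝ} (hu : AEStronglyMeasurable u volume)
    (hv : AEStronglyMeasurable v volume) :
    AEStronglyMeasurable (formIntegrand J u v) (volume.prod volume) := by
  rw [formIntegrand_eq hJ]
  exact (aestronglyMeasurable_energy hJ hu hv).comp_measurePreserving measurePreserving_shear

theorem integrable_formIntegrand_of_energy {u : Euc N → ℝ} (hu : AEStronglyMeasurable u volume)
    (hE : dirichletEnergy J u < ∞) : Integrable (formIntegrand J u u) (volume.prod volume) := by
  rw [formIntegrand_eq hJ, measurePreserving_shear.integrable_comp_emb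
    (MeasurableEquiv.measurableEmbedding _)]
  refine ⟨aestronglyMeasurable_energy hJ hu hu, ?_⟩
  rw [hasFiniteIntegral_iff_ofReal (Eventually.of_forall fun z =>
      mul_nonneg (mul_self_nonneg _) (hJ.nonneg _)),
    lintegral_prod _ (aestronglyMeasurable_energy hJ hu hu).aemeasurable.ennreal_ofReal]
  rw [dirichletEnergy] at hE
  have h := ENNReal.lt_top_of_mul_ne_top_right hE.ne (by simp)
  simpa only [sq] using h

/-- Integrating first in `x` turns the energy density at jump `w` into `2 ⟨V, V - symShift w V⟩`,
which is integrable against the Lévy measure. -/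
theorem integrable_formIntegrand_of_isTest {V : EucL2 N} (hVt : IsTest V) {v : Euc N → ℝ}
    (hV : V =ᵐ[volume] v) :
    Integrable (formIntegrand J v v) (volume.prod volume) := by
  have hv : AEStronglyMeasurable v volume := (Lp.aestronglyMeasurable V).congr hV
  refine (integrable_prod_iff' (aestronglyMeasurable_formIntegrand hJ hv hv)).2 ⟨?_, ?_⟩
  · exact Eventually.of_forall fun w => (integral_diff_mul_diff hV hV w).1.mul_const (J w)
  · have h1 : (fun w => ∫ x, ‖formIntegrand J v v (x, w)‖)
        = fun w => J w • (2 * inner ℝ V (V - symShift w V)) := by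
      funext w
      have h2 : ∀ x, ‖formIntegrand J v v (x, w)‖
          = (v x - v (x + w)) * (v x - v (x + w)) * J w := fun x =>
        Real.norm_of_nonneg (mul_nonneg (mul_self_nonneg _) (hJ.nonneg _))
      simp only [h2]
      rw [integral_mul_const, (integral_diff_mul_diff hV hV w).2, mul_comm, smul_eq_mul]
    rw [h1, ← integrable_levyMeasure_iff hJ]
    exact ((integrable_sub_symShift hJ hVt).const_inner V).const_mul 2

/-- On smooth test functions the Dirichlet form is given by the generator. -/
theorem dirichletForm_eq_inner_levyGen {U V : EucL2 N} {u v : Euc N → ℝ} (hU : U =ᵐ[volume] u)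
    (hE : dirichletEnergy J u < ∞) (hVt : IsTest V) (hV : V =ᵐ[volume] v) :
    dirichletForm J u v = inner ℝ U (levyGen J V) := by
  have hu : AEStronglyMeasurable u volume := (Lp.aestronglyMeasurable U).congr hU
  have hv : AEStronglyMeasurable v volume := (Lp.aestronglyMeasurable V).congr hV
  -- The mixed integrand is dominated by the sum of the two energy densities, which justifies
  -- Fubini.
  have hint : Integrable (formIntegrand J u v) (volume.prod volume) := by
    refine ((integrable_formIntegrand_of_energy hJ hu hE).add
      (integrable_formIntegrand_of_isTest hJ hVt hV)).mono'
      (aestronglyMeasurable_formIntegrand hJ hu hv) (Eventually.of_forall fun w => ?_)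
    simp only [formIntegrand, Pi.add_apply]
    rw [norm_mul, Real.norm_of_nonneg (hJ.nonneg w.2), ← add_mul]
    refine mul_le_mul_of_nonneg_right ?_ (hJ.nonneg w.2)
    rw [Real.norm_eq_abs, abs_le]
    constructor <;> nlinarith [sq_nonneg ((u w.1 - u (w.1 + w.2)) + (v w.1 - v (w.1 + w.2))),
      sq_nonneg ((u w.1 - u (w.1 + w.2)) - (v w.1 - v (w.1 + w.2))),
      sq_nonneg (u w.1 - u (w.1 + w.2)), sq_nonneg (v w.1 - v (w.1 + w.2))]
  rw [dirichletForm_eq_integral_formIntegrand hJ, integral_prod_symm _ hint, levyGen,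
    ← integral_inner (integrable_sub_symShift hJ hVt), integral_levyMeasure hJ,
    ← integral_const_mul]
  refine integral_congr_ae (Eventually.of_forall fun w => ?_)
  simp only [formIntegrand, smul_eq_mul]
  rw [integral_mul_const, (integral_diff_mul_diff hU hV w).2]
  ring

end NonlocalHeat

/-! ### A weak solution as an integrable curve in `L²`. -/

namespace NonlocalHeat

section Pettis

variable {H : Type*} [NormedAddCommGroup H] [InnerProductSpace ℝ H]

/-- Distinct orthonormal vectors are at distance `√2`, so balls of radius `1/2` about them are
disjoint. -/
theorem countable_of_orthonormal [TopologicalSpace.SeparableSpace H] {w : Set H}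
    (hw : Orthonormal ℝ ((↑) : w → H)) : w.Countable := by
  refine Set.PairwiseDisjoint.countable_of_isOpen (s := fun e : H => Metric.ball e (1 / 2)) ?_
    (fun _ _ => Metric.isOpen_ball) fun e _ => ⟨e, Metric.mem_ball_self (by norm_num)⟩
  intro e he e' he' hne
  refine Metric.ball_disjoint_ball ?_
  have h1 : ‖e‖ = 1 := hw.1 ⟨e, he⟩
  have h2 : ‖e'‖ = 1 := hw.1 ⟨e', he'⟩
  have h3 : inner ℝ e e' = 0 := hw.2 (i := ⟨e, he⟩) (j := ⟨e', he'⟩) (by simpa using hne)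
  have h4 := norm_sub_sq_real e e'
  rw [h1, h2, h3] at h4
  rw [dist_eq_norm]
  nlinarith [norm_nonneg (e - e')]

/-- Pettis' theorem in a separable Hilbert space. -/
theorem aestronglyMeasurable_of_inner [CompleteSpace H] [TopologicalSpace.SeparableSpace H]
    {X : Type*} [MeasurableSpace X] {μ : Measure X} {v : X → H}
    (h : ∀ f : H, AEStronglyMeasurable (fun t => inner ℝ f (v t)) μ) :
    AEStronglyMeasurable v μ := by
  obtain ⟨w, b, hb⟩ := exists_hilbertBasis ℝ H
  have hw : w.Countable := countable_of_orthonormal (hb ▸ b.orthonormal)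
  have : Countable w := hw.to_subtype
  refine aestronglyMeasurable_of_tendsto_ae atTop
    (f := fun (s : Finset w) t => ∑ i ∈ s, b.repr (v t) i • b i) (fun s => ?_)
    (Eventually.of_forall fun t => b.hasSum_repr (v t))
  refine Finset.aestronglyMeasurable_fun_sum s fun i _ => ?_
  simp only [b.repr_apply_apply]
  exact (h (b i)).smul_const _

end Pettis

variable {N : ℕ} {J u₀ : Euc N → ℝ} {u : ℝ → Euc N → ℝ}

open Classical in
/-- A family of functions as a curve in `L²`. -/
def toCurve (u : ℝ → Euc N → ℝ) (t : ℝ) : EucL2 N :=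
  if h : MemLp (u t) 2 volume then h.toLp else 0

theorem coeFn_toCurve {t : ℝ} (h : MemLp (u t) 2 volume) : toCurve u t =ᵐ[volume] u t := by
  rw [toCurve, dif_pos h]
  exact h.coeFn_toLp

theorem dirichletEnergy_congr {f g : Euc N → ℝ} (h : f =ᵐ[volume] g) :
    dirichletEnergy J f = dirichletEnergy J g := by
  unfold dirichletEnergy
  congr 1
  refine lintegral_congr_ae ?_
  filter_upwards [h] with x hx
  refine lintegral_congr_ae ?_
  filter_upwards [h] with y hy
  rw [hx, hy]

variable (hJ : IsLevyKernel J) (hu : IsWeakSolution J u₀ u)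
include hJ hu

/-- A finite integral gives almost everywhere finiteness once the integrand is known to be
measurable in `t`. A jointly measurable representative of `u` supplies this. -/
theorem ae_memLp_and_energy {T : ℝ} (hT : 0 < T) :
    ∀ᵐ t ∂(volume.restrict (Ioo 0 T)), MemLp (u t) 2 volume ∧ dirichletEnergy J (u t) < ∞ := by
  have hm := (hu.integrable T hT).aestronglyMeasurable
  set w := hm.mk with hw
  have hwm : Measurable w := hm.stronglyMeasurable_mk.measurable
  have hae : ∀ᵐ t ∂(volume.restrict (Ioo 0 T)), u t =ᵐ[volume] fun x => w (t, x) :=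
    Measure.ae_ae_of_ae_prod hm.ae_eq_mk
  have hmeas : AEMeasurable (fun t => eLpNorm (u t) 2 volume ^ 2 + dirichletEnergy J (u t))
      (volume.restrict (Ioo 0 T)) := by
    refine ⟨fun t => eLpNorm (fun x => w (t, x)) 2 volume ^ 2
      + dirichletEnergy J (fun x => w (t, x)), ?_, ?_⟩
    · have h1 : Measurable fun t => eLpNorm (fun x => w (t, x)) 2 volume := by
        simp only [eLpNorm_eq_lintegral_rpow_enorm_toReal (two_ne_zero) (ENNReal.ofNat_ne_top)]
        exact (Measurable.lintegral_prod_right' (f := fun z : ℝ × Euc N => ‖w z‖ₑ ^ (2 : ℝ≥0∞).toReal)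
          (hwm.enorm.pow_const _)).pow_const _
      have h2 : Measurable fun t => dirichletEnergy J (fun x => w (t, x)) := by
        unfold dirichletEnergy
        refine Measurable.const_mul ?_ _
        refine Measurable.lintegral_prod_right' (f := fun z : ℝ × Euc N =>
          ∫⁻ y, ENNReal.ofReal ((w (z.1, z.2) - w (z.1, y)) ^ 2 * J (z.2 - y))) ?_
        refine Measurable.lintegral_prod_right' (f := fun z : (ℝ × Euc N) × Euc N =>
          ENNReal.ofReal ((w (z.1.1, z.1.2) - w (z.1.1, z.2)) ^ 2 * J (z.1.2 - z.2))) ?_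
        have hJm := hJ.measurable
        fun_prop
      exact (h1.pow_const 2).add h2
    · filter_upwards [hae] with t ht
      rw [eLpNorm_congr_ae ht, dirichletEnergy_congr ht]
  filter_upwards [ae_lt_top' hmeas (hu.energy_lt_top T hT).ne, hae] with t h1 h2
  rw [ENNReal.add_lt_top] at h1
  refine ⟨⟨?_, ?_⟩, h1.2⟩
  · exact AEStronglyMeasurable.congr
      (hwm.comp measurable_prodMk_left).stronglyMeasurable.aestronglyMeasurable h2.symm
  · by_contra h
    rw [not_lt_top_iff] at h
    rw [h] at h1
    simp at h1

theorem integrable_toCurve {T : ℝ} (hT : 0 < T) :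
    Integrable (toCurve u) (volume.restrict (Ioo 0 T)) := by
  have hm := (hu.integrable T hT).aestronglyMeasurable
  have hgood := ae_memLp_and_energy hJ hu hT
  have : Fact ((2 : ℝ≥0∞) ≠ ∞) := ⟨by simp⟩
  have hmeas : AEStronglyMeasurable (toCurve u) (volume.restrict (Ioo 0 T)) := by
    refine aestronglyMeasurable_of_inner fun f => ?_
    have h1 : AEStronglyMeasurable (fun z : ℝ × Euc N => f z.2 * Function.uncurry u z)
        ((volume.restrict (Ioo 0 T)).prod volume) :=
      ((Lp.aestronglyMeasurable f).comp_snd).mul hm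
    refine h1.integral_prod_right'.congr ?_
    filter_upwards [hgood] with t ht
    rw [L2.inner_def]
    refine integral_congr_ae ?_
    filter_upwards [coeFn_toCurve ht.1] with x hx
    rw [hx, real_inner_eq_re_inner, RCLike.inner_apply']
    simp [Function.uncurry]
  refine ⟨hmeas, ?_⟩
  have hfin : ∫⁻ t in Ioo 0 T, (1 + (eLpNorm (u t) 2 volume ^ 2 + dirichletEnergy J (u t))) < ∞ := by
    rw [lintegral_add_left measurable_const]
    refine ENNReal.add_lt_top.2 ⟨?_, hu.energy_lt_top T hT⟩
    simp
  refine lt_of_le_of_lt (lintegral_mono_ae ?_) hfin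
  filter_upwards [hgood] with t ht
  have h1 : ‖toCurve u t‖ₑ = eLpNorm (u t) 2 volume := by
    rw [Lp.enorm_def, eLpNorm_congr_ae (coeFn_toCurve ht.1)]
  rw [h1]
  set a := eLpNorm (u t) 2 volume
  calc a ≤ 1 + a ^ 2 := by
        rcases le_total a 1 with h | h
        · exact h.trans le_self_add
        · exact (le_self_pow₀ h two_ne_zero).trans le_add_self
    _ ≤ _ := by gcongr; exact le_self_add

end NonlocalHeat

/-! ### Testing the equation with `((t - s)⁺)² ψ(x)`. -/

namespace NonlocalHeat

theorem hasDerivAt_posPart_sq (x : ℝ) :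
    HasDerivAt (fun y : ℝ => max y 0 ^ 2) (2 * max x 0) x := by
  rcases lt_trichotomy x 0 with h | h | h
  · rw [max_eq_right h.le, mul_zero]
    refine (hasDerivAt_const x (0 : ℝ)).congr_of_eventuallyEq ?_
    filter_upwards [Iio_mem_nhds h] with y hy
    rw [max_eq_right (le_of_lt hy)]
    norm_num
  · subst h
    rw [max_self, mul_zero, hasDerivAt_iff_isLittleO]
    simp only [max_self, sub_zero, smul_zero, ne_eq, OfNat.ofNat_ne_zero, not_false_eq_true,
      zero_pow]
    refine Asymptotics.IsBigO.trans_isLittleO (g := fun y : ℝ => y ^ 2) ?_ ?_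
    · refine Asymptotics.isBigO_of_le _ fun y => ?_
      rw [norm_pow, norm_pow]
      gcongr
      rw [Real.norm_of_nonneg (le_max_right _ _)]
      exact max_le (le_abs_self y) (abs_nonneg y)
    · exact Asymptotics.isLittleO_pow_id one_lt_two
  · rw [max_eq_left h.le]
    have h1 := hasDerivAt_pow 2 x
    norm_num at h1
    refine h1.congr_of_eventuallyEq ?_
    filter_upwards [Ioi_mem_nhds h] with y hy
    rw [max_eq_left (le_of_lt hy)]

theorem hasDerivAt_kernel (s t : ℝ) :
    HasDerivAt (fun s : ℝ => max (t - s) 0 ^ 2) (-(2 * max (t - s) 0)) s := by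
  have := (hasDerivAt_posPart_sq (t - s)).scomp s ((hasDerivAt_id s).const_sub t)
  simpa [Function.comp_def] using this

/-- A time cutoff equal to `((t - s)⁺)²` for `s ≥ 0`. -/
theorem exists_time_cutoff (t : ℝ) :
    ∃ η : ℝ → ℝ, ContDiff ℝ 1 η ∧ HasCompactSupport η ∧
      (∀ s, 0 ≤ s → η s = max (t - s) 0 ^ 2) ∧
      ∀ s, 0 < s → HasDerivAt η (-(2 * max (t - s) 0)) s := by
  -- The square makes the kernel `C¹` at `s = t`. The bump equals one on `[0, t]` and only cuts off
  -- negative times, where the kernel does not vanish.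
  let χ : ContDiffBump (0 : ℝ) := ⟨|t| + 1, |t| + 2, by positivity, by linarith⟩
  have heq : ∀ s, 0 ≤ s → χ s * max (t - s) 0 ^ 2 = max (t - s) 0 ^ 2 := by
    intro s hs
    rcases le_total t s with h | h
    · rw [max_eq_right (by linarith)]
      norm_num
    · rw [χ.one_of_mem_closedBall, one_mul]
      rw [Metric.mem_closedBall, Real.dist_eq, sub_zero, abs_of_nonneg hs]
      change s ≤ |t| + 1
      linarith [le_abs_self t]
  have hd : ContDiff ℝ 1 fun s : ℝ => max (t - s) 0 ^ 2 := by
    rw [contDiff_one_iff_deriv]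
    refine ⟨fun s => (hasDerivAt_kernel s t).differentiableAt, ?_⟩
    have : deriv (fun s : ℝ => max (t - s) 0 ^ 2) = fun s => -(2 * max (t - s) 0) :=
      funext fun s => (hasDerivAt_kernel s t).deriv
    rw [this]
    fun_prop
  refine ⟨fun s => χ s * max (t - s) 0 ^ 2, χ.contDiff.mul hd, χ.hasCompactSupport.mul_right, heq,
    fun s hs => ?_⟩
  refine (hasDerivAt_kernel s t).congr_of_eventuallyEq ?_
  filter_upwards [Ioi_mem_nhds hs] with r hr using heq r (le_of_lt hr)

theorem integrable_continuous_smul {H : Type*} [NormedAddCommGroup H] [NormedSpace ℝ H] {T : ℝ}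
    {d : ℝ → H} (hd : Integrable d (volume.restrict (Ioo 0 T))) {φ : ℝ → ℝ} (hφ : Continuous φ) :
    Integrable (fun s => φ s • d s) (volume.restrict (Ioo 0 T)) := by
  obtain ⟨C, hC⟩ := (isCompact_Icc (a := (0 : ℝ)) (b := T)).exists_bound_of_continuousOn
    hφ.continuousOn
  refine hd.bdd_smul (φ := φ) C hφ.aestronglyMeasurable ?_
  filter_upwards [ae_restrict_mem measurableSet_Ioo] with s hs using hC s ⟨hs.1.le, hs.2.le⟩

variable {N : ℕ} {J u₀ : Euc N → ℝ} {u : ℝ → Euc N → ℝ}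

theorem dirichletForm_const_mul (f g : Euc N → ℝ) (c : ℝ) :
    dirichletForm J f (fun x => c * g x) = c * dirichletForm J f g := by
  unfold dirichletForm
  rw [mul_left_comm, ← integral_const_mul c]
  congr 2
  funext z
  ring

theorem integral_mul_eq_inner {U V : EucL2 N} {f g : Euc N → ℝ} (hU : U =ᵐ[volume] f)
    (hV : V =ᵐ[volume] g) : ∫ x, f x * g x = inner ℝ U V := by
  rw [L2.inner_def]
  refine integral_congr_ae ?_
  filter_upwards [hU, hV] with x h1 h2
  rw [← h1, ← h2, real_inner_eq_re_inner, RCLike.inner_apply']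
  simp

theorem ae_Ioi_of_ae_Ioo {p : ℝ → Prop} (h : ∀ T : ℝ, 0 < T → ∀ᵐ t ∂(volume.restrict (Ioo 0 T)), p t) :
    ∀ᵐ t ∂(volume.restrict (Ioi (0 : ℝ))), p t := by
  have hU : Ioi (0 : ℝ) = ⋃ n : ℕ, Ioo 0 ((n : ℝ) + 1) := by
    ext t
    simp only [mem_Ioi, mem_iUnion, mem_Ioo, exists_and_left, iff_self_and]
    intro _
    obtain ⟨n, hn⟩ := exists_nat_gt t
    exact ⟨n, by linarith⟩
  rw [hU, ae_restrict_iUnion_iff]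
  exact fun n => h _ (by positivity)

variable (hJ : IsLevyKernel J) (hu : IsWeakSolution J u₀ u)
include hJ hu

theorem weak_eq_kernel_Ioi {U₀ Ψ : EucL2 N} (hU₀ : U₀ =ᵐ[volume] u₀) (hΨ : IsTest Ψ) {t : ℝ}
    (ht : 0 ≤ t) :
    (∫ s in Ioi (0 : ℝ), -(2 * max (t - s) 0) * inner ℝ (toCurve u s) Ψ) + t ^ 2 * inner ℝ U₀ Ψ
      = ∫ s in Ioi (0 : ℝ), max (t - s) 0 ^ 2 * inner ℝ (toCurve u s) (levyGen J Ψ) := by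
  obtain ⟨η, hη, hηc, hη0, hηd⟩ := exists_time_cutoff t
  obtain ⟨ψ, hψ, hψc, hψs⟩ := id hΨ
  have hgood := ae_Ioi_of_ae_Ioo fun T hT => ae_memLp_and_energy hJ hu hT
  have h := hu.weak_eq (fun s x => η s * ψ x)
    ((hη.comp contDiff_fst).mul ((hψs.of_le (by exact_mod_cast le_top)).comp contDiff_snd))
    (HasCompactSupport.intro (K := tsupport η ×ˢ tsupport ψ) (hηc.isCompact.prod hψc.isCompact)
      (fun z hz => by
        rw [mem_prod, not_and_or] at hz
        rcases hz with hz | hz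
        · simp [Function.uncurry, image_eq_zero_of_notMem_tsupport hz]
        · simp [Function.uncurry, image_eq_zero_of_notMem_tsupport hz]))
  have e1 : ∫ s in Ioi (0 : ℝ), ∫ x, u s x * deriv (fun r => η r * ψ x) s
      = ∫ s in Ioi (0 : ℝ), -(2 * max (t - s) 0) * inner ℝ (toCurve u s) Ψ := by
    refine integral_congr_ae ?_
    filter_upwards [hgood, ae_restrict_mem measurableSet_Ioi] with s h1 h2
    rw [← integral_mul_eq_inner (coeFn_toCurve h1.1) hψ, ← integral_const_mul]
    congr 1
    funext x
    rw [((hηd s h2).mul_const (ψ x)).deriv]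
    ring
  have e2 : ∫ x, η 0 * ψ x * u₀ x = t ^ 2 * inner ℝ U₀ Ψ := by
    rw [← integral_mul_eq_inner hU₀ hψ, ← integral_const_mul, hη0 0 le_rfl, sub_zero,
      max_eq_left ht]
    congr 1
    funext x
    ring
  have e3 : ∫ s in Ioi (0 : ℝ), dirichletForm J (u s) (fun x => η s * ψ x)
      = ∫ s in Ioi (0 : ℝ), max (t - s) 0 ^ 2 * inner ℝ (toCurve u s) (levyGen J Ψ) := by
    refine integral_congr_ae ?_
    filter_upwards [hgood, ae_restrict_mem measurableSet_Ioi] with s h1 h2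
    rw [dirichletForm_const_mul, hη0 s (le_of_lt h2),
      dirichletForm_eq_inner_levyGen hJ (coeFn_toCurve h1.1) h1.2 hΨ hψ]
  rw [e1, e2, e3] at h
  exact h

omit hJ hu in
theorem setIntegral_Ioi_eq_Ioo {t T : ℝ} (htT : t ≤ T) {f : ℝ → ℝ}
    (hf : ∀ s, t ≤ s → f s = 0) : ∫ s in Ioi (0 : ℝ), f s = ∫ s in Ioo 0 T, f s := by
  refine setIntegral_eq_of_subset_of_forall_sdiff_eq_zero measurableSet_Ioi
    (fun s hs => hs.1) fun s hs => hf s ?_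
  by_contra h
  exact hs.2 ⟨hs.1, by linarith⟩

/-- This is `X' + 𝓛X = t² u₀` tested with `Ψ`, where `X(t)` is the time integral of `u` against the
squared kernel. Unlike `u`, the curve `X` is differentiable in `L²`. -/
theorem weak_eq_kernel {U₀ Ψ : EucL2 N} (hU₀ : U₀ =ᵐ[volume] u₀) (hΨ : IsTest Ψ) {t T : ℝ}
    (ht : 0 ≤ t) (htT : t ≤ T) (hT : 0 < T) :
    inner ℝ (∫ s in Ioo 0 T, (2 * max (t - s) 0) • toCurve u s) Ψ
      + inner ℝ (∫ s in Ioo 0 T, max (t - s) 0 ^ 2 • toCurve u s) (levyGen J Ψ)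
      = t ^ 2 * inner ℝ U₀ Ψ := by
  have hint := integrable_toCurve hJ hu hT
  have hi1 : Integrable (fun s => (2 * max (t - s) 0) • toCurve u s) (volume.restrict (Ioo 0 T)) :=
    integrable_continuous_smul hint (by fun_prop)
  have hi2 : Integrable (fun s => max (t - s) 0 ^ 2 • toCurve u s) (volume.restrict (Ioo 0 T)) :=
    integrable_continuous_smul hint (by fun_prop)
  have h := weak_eq_kernel_Ioi hJ hu hU₀ hΨ ht
  rw [setIntegral_Ioi_eq_Ioo htT (fun s hs => by rw [max_eq_right (by linarith)]; ring),
    setIntegral_Ioi_eq_Ioo htT (fun s hs => by rw [max_eq_right (by linarith)]; ring)] at h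
  rw [real_inner_comm, ← integral_inner hi1, real_inner_comm _ (∫ s in Ioo 0 T, _),
    ← integral_inner hi2]
  have hc : ∀ (Φ : EucL2 N) s, inner ℝ (toCurve u s) Φ = inner ℝ Φ (toCurve u s) :=
    fun Φ s => real_inner_comm _ _
  simp only [hc, neg_mul, integral_neg] at h
  simp only [real_inner_smul_right]
  linarith

end NonlocalHeat

/-! ### Differentiating the time kernels, and relations invariant under translation. -/

namespace NonlocalHeat

section Kernel

variable {H : Type*} [NormedAddCommGroup H] [NormedSpace ℝ H] {T : ℝ}
  {d : ℝ → H}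

theorem hasDerivAt_integral_kernel_sq (hd : Integrable d (volume.restrict (Ioo 0 T))) (t : ℝ) :
    HasDerivAt (fun t => ∫ s in Ioo 0 T, max (t - s) 0 ^ 2 • d s)
      (∫ s in Ioo 0 T, (2 * max (t - s) 0) • d s) t := by
  refine (hasDerivAt_integral_of_dominated_loc_of_deriv_le (𝕜 := ℝ) (s := Metric.ball t 1)
    (F := fun t s => max (t - s) 0 ^ 2 • d s) (F' := fun t s => (2 * max (t - s) 0) • d s)
    (bound := fun s => (2 * (|t| + 1)) * ‖d s‖) (Metric.ball_mem_nhds t one_pos)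
    (Eventually.of_forall fun r =>
      (integrable_continuous_smul hd (by fun_prop)).aestronglyMeasurable)
    (integrable_continuous_smul hd (by fun_prop))
    (integrable_continuous_smul hd (by fun_prop)).aestronglyMeasurable ?_
    (hd.norm.const_mul _) ?_).2
  · filter_upwards [ae_restrict_mem measurableSet_Ioo] with s hs r hr
    rw [norm_smul, Real.norm_of_nonneg (by positivity)]
    rw [Metric.mem_ball, Real.dist_eq, abs_lt] at hr
    gcongr
    exact max_le (by linarith [hs.1, le_abs_self t]) (by positivity)
  · refine Eventually.of_forall fun s r _ => ?_
    have := (hasDerivAt_posPart_sq (r - s)).scomp r ((hasDerivAt_id r).sub_const s)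
    simpa [Function.comp_def] using this.smul_const (d s)

/-- The kernel is Lipschitz in `t` and differentiable except at `s = t`, a null set. -/
theorem hasDerivAt_integral_kernel (hd : Integrable d (volume.restrict (Ioo 0 T))) (t : ℝ) :
    HasDerivAt (fun t => ∫ s in Ioo 0 T, (2 * max (t - s) 0) • d s)
      (∫ s in Ioo 0 T, (Iio t).indicator (fun s => (2 : ℝ) • d s) s) t := by
  refine (hasDerivAt_integral_of_dominated_loc_of_lip (𝕜 := ℝ) (s := univ)
    (F := fun t s => (2 * max (t - s) 0) • d s)
    (F' := fun s => (Iio t).indicator (fun s => (2 : ℝ) • d s) s)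
    (bound := fun s => 2 * ‖d s‖) univ_mem
    (Eventually.of_forall fun r =>
      (integrable_continuous_smul hd (by fun_prop)).aestronglyMeasurable)
    (integrable_continuous_smul hd (by fun_prop))
    ((hd.smul (2 : ℝ)).aestronglyMeasurable.indicator measurableSet_Iio) ?_
    (hd.norm.const_mul _) ?_).2
  · refine Eventually.of_forall fun s => LipschitzOnWith.of_dist_le_mul fun x _ y _ => ?_
    rw [dist_eq_norm, ← sub_smul, norm_smul, Real.coe_nnabs, abs_of_nonneg (by positivity),
      ← mul_sub, norm_mul, Real.norm_of_nonneg (by norm_num : (0 : ℝ) ≤ 2), mul_right_comm]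
    gcongr
    have := abs_max_sub_max_le_abs (x - s) (y - s) 0
    rw [sub_sub_sub_cancel_right] at this
    exact this
  · have hne : ∀ᵐ s ∂(volume.restrict (Ioo 0 T)), s ≠ t :=
      ae_restrict_of_ae (compl_mem_ae_iff.2 (measure_singleton t))
    filter_upwards [hne] with s hs
    rcases lt_or_gt_of_ne hs with h | h
    · rw [indicator_of_mem (mem_Iio.2 h)]
      have h1 : HasDerivAt (fun r : ℝ => 2 * (r - s)) 2 t := by
        simpa using ((hasDerivAt_id t).sub_const s).const_mul (2 : ℝ)
      refine (h1.smul_const (d s)).congr_of_eventuallyEq ?_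
      filter_upwards [Ioi_mem_nhds h] with r hr
      rw [max_eq_left (by linarith [mem_Ioi.1 hr])]
    · rw [indicator_of_notMem (by simpa using h.le)]
      refine (hasDerivAt_const t (0 : H)).congr_of_eventuallyEq ?_
      filter_upwards [Iio_mem_nhds h] with r hr
      rw [max_eq_right (by linarith [mem_Iio.1 hr]), mul_zero, zero_smul]

/-- Two differentiations reduce the hypothesis to vanishing primitives of `d`; Lebesgue's
differentiation theorem concludes. -/
theorem ae_eq_zero_of_integral_kernel_sq_eq_zero [CompleteSpace H]
    (hd : Integrable d (volume.restrict (Ioo 0 T)))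
    (h : ∀ t ∈ Ioo 0 T, ∫ s in Ioo 0 T, max (t - s) 0 ^ 2 • d s = 0) :
    ∀ᵐ t ∂(volume.restrict (Ioo 0 T)), d t = 0 := by
  have h1 : ∀ t ∈ Ioo 0 T, ∫ s in Ioo 0 T, (2 * max (t - s) 0) • d s = 0 := by
    intro t ht
    refine (hasDerivAt_integral_kernel_sq hd t).unique
      ((hasDerivAt_const t (0 : H)).congr_of_eventuallyEq ?_)
    filter_upwards [isOpen_Ioo.mem_nhds ht] with r hr using h r hr
  have h2 : ∀ t ∈ Ioo 0 T, ∫ s in Ioo 0 T, (Iio t).indicator (fun s => (2 : ℝ) • d s) s = 0 := by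
    intro t ht
    refine (hasDerivAt_integral_kernel hd t).unique
      ((hasDerivAt_const t (0 : H)).congr_of_eventuallyEq ?_)
    filter_upwards [isOpen_Ioo.mem_nhds ht] with r hr using h1 r hr
  set e : ℝ → H := (Ioo 0 T).indicator d with he
  have hei : Integrable e volume := (integrable_indicator_iff measurableSet_Ioo).2 hd
  have h3 : ∀ t ∈ Ioo 0 T, ∫ s in (0 : ℝ)..t, e s = 0 := by
    intro t ht
    have h4 := h2 t ht
    rw [setIntegral_indicator measurableSet_Iio, integral_smul] at h4
    have h5 := (smul_eq_zero.1 h4).resolve_left two_ne_zero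
    rw [intervalIntegral.integral_of_le ht.1.le, he, setIntegral_indicator measurableSet_Ioo]
    have h6 : (Ioc 0 t ∩ Ioo 0 T : Set ℝ) =ᵐ[volume] (Ioo 0 T ∩ Iio t : Set ℝ) := by
      have h7 : Ioo 0 T ∩ Iio t = Ioo 0 t := by
        ext s
        simp only [mem_inter_iff, mem_Ioo, mem_Iio]
        constructor
        · rintro ⟨⟨a, -⟩, b⟩
          exact ⟨a, b⟩
        · rintro ⟨a, b⟩
          exact ⟨⟨a, b.trans ht.2⟩, b⟩
      have h8 : Ioc 0 t ∩ Ioo 0 T = Ioc 0 t := by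
        refine inter_eq_left.2 fun s hs => ⟨hs.1, hs.2.trans_lt ht.2⟩
      rw [h7, h8]
      exact Ioo_ae_eq_Ioc.symm
    rw [setIntegral_congr_set h6, h5]
  rw [ae_restrict_iff' measurableSet_Ioo]
  filter_upwards [_root_.LocallyIntegrable.ae_hasDerivAt_integral hei.locallyIntegrable] with t ht hmem
  have h9 := (ht 0).unique ((hasDerivAt_const t (0 : H)).congr_of_eventuallyEq (by
    filter_upwards [isOpen_Ioo.mem_nhds hmem] with r hr using h3 r hr))
  rwa [he, indicator_of_mem hmem] at h9

end Kernel

section Annihilator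

variable {N : ℕ} (a b : EucL2 N)

/-- The pair `(f, g)` and all its translates annihilate `(a, b)`. -/
def Annihilates (f g : EucL2 N) : Prop :=
  ∀ z, inner ℝ a (shift z f) + inner ℝ b (shift z g) = 0

variable {a b}

theorem Annihilates.smul {f g : EucL2 N} (h : Annihilates a b f g) (c : ℝ) :
    Annihilates a b (c • f) (c • g) := by
  intro z
  rw [map_smul, map_smul, real_inner_smul_right, real_inner_smul_right, ← mul_add, h z, mul_zero]

theorem Annihilates.sub {f g f' g' : EucL2 N} (h : Annihilates a b f g)
    (h' : Annihilates a b f' g') : Annihilates a b (f - f') (g - g') := by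
  intro z
  rw [map_sub, map_sub, inner_sub_right, inner_sub_right]
  linarith [h z, h' z]

variable (ν : Measure (Euc N)) [IsFiniteMeasure ν]

theorem Annihilates.avg {f g : EucL2 N} (h : Annihilates a b f g) :
    Annihilates a b (avg ν f) (avg ν g) := by
  intro z
  rw [← avg_shift, ← avg_shift, avg_apply, avg_apply, ← integral_inner (integrable_symShift ν _),
    ← integral_inner (integrable_symShift ν _), ← integral_add
      ((integrable_symShift ν _).const_inner a) ((integrable_symShift ν _).const_inner b)]
  refine integral_eq_zero_of_ae (Eventually.of_forall fun w => ?_)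
  simp only [symShift_apply, shift_add, real_inner_smul_right, inner_add_right, Pi.zero_apply]
  linarith [h (w + z), h (-w + z)]

theorem Annihilates.gen {f g : EucL2 N} (h : Annihilates a b f g) :
    Annihilates a b (gen ν f) (gen ν g) := by
  rw [gen_apply, gen_apply]
  exact (h.smul _).sub (h.avg ν)

theorem Annihilates.pow {T : EucL2 N →L[ℝ] EucL2 N}
    (hT : ∀ f g, Annihilates a b f g → Annihilates a b (T f) (T g)) {f g : EucL2 N}
    (h : Annihilates a b f g) (n : ℕ) : Annihilates a b ((T ^ n) f) ((T ^ n) g) := by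
  induction n with
  | zero => exact h
  | succ n ih =>
    rw [pow_succ', mul_apply_eq_comp, mul_apply_eq_comp]
    exact hT _ _ ih

theorem Annihilates.exp {T : EucL2 N →L[ℝ] EucL2 N}
    (hT : ∀ f g, Annihilates a b f g → Annihilates a b (T f) (T g)) {f g : EucL2 N}
    (h : Annihilates a b f g) :
    inner ℝ a (NormedSpace.exp T f) + inner ℝ b (NormedSpace.exp T g) = 0 := by
  have h1 := ((hasSum_exp_apply T f).mapL (innerSL ℝ a)).add
    ((hasSum_exp_apply T g).mapL (innerSL ℝ b))
  have h2 : (fun n : ℕ => innerSL ℝ a ((n.factorial : ℝ)⁻¹ • (T ^ n) f)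
      + innerSL ℝ b ((n.factorial : ℝ)⁻¹ • (T ^ n) g)) = fun _ => 0 := by
    funext n
    have := ((h.pow hT n).smul (n.factorial : ℝ)⁻¹) 0
    rw [shift_zero, shift_zero] at this
    simpa only [innerSL_apply_apply] using this
  rw [h2] at h1
  simpa only [innerSL_apply_apply] using h1.unique hasSum_zero

/-- The image of a test function under the semigroup need not have compact support, so it cannot be
inserted in the weak equation. The semigroup is built from translations by means, sums and limits,
and the relation passes through each of these. -/
theorem Annihilates.inner_semi {f g : EucL2 N} (h : Annihilates a b f g) (t : ℝ) :
    inner ℝ a (semi ν t f) + inner ℝ b (semi ν t g) = 0 := by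
  unfold semi
  refine h.exp (T := (-t) • NonlocalHeat.gen ν) fun f g hfg => ?_
  rw [smul_apply, smul_apply]
  exact (hfg.gen ν).smul (-t)

end Annihilator

section TestShift

variable {N : ℕ} {J : Euc N → ℝ}

theorem IsTest.shift {f : EucL2 N} (hf : IsTest f) (z : Euc N) : IsTest (shift z f) := by
  obtain ⟨g, hfg, hg, hg2⟩ := hf
  refine ⟨fun x => g (x - z), ?_, ?_, ?_⟩
  · filter_upwards [coeFn_shift z f, ae_eq_comp_sub hfg z] with x h1 h2
    rw [h1, h2]
  · exact hg.comp_homeomorph (Homeomorph.subRight z)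
  · exact hg2.comp (contDiff_id.sub contDiff_const)

theorem levyGen_shift (hJ : IsLevyKernel J) {f : EucL2 N} (hf : IsTest f) (z : Euc N) :
    levyGen J (shift z f) = shift z (levyGen J f) := by
  rw [levyGen, levyGen]
  have h := ContinuousLinearMap.integral_comp_comm (NonlocalHeat.shift z).toContinuousLinearMap
    (integrable_sub_symShift hJ hf)
  refine Eq.trans ?_ h
  refine integral_congr_ae (Eventually.of_forall fun w => ?_)
  simp only [LinearIsometry.coe_toContinuousLinearMap, map_sub, symShift_shift]

end TestShift

end NonlocalHeat

/-! ### Weak solutions are given by the limit semigroup. -/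

namespace NonlocalHeat

variable {N : ℕ} {J u₀ : Euc N → ℝ} {u : ℝ → Euc N → ℝ}

/-- `∫₀ᵗ (t - s)² u(s) ds`, for `t ≤ T`. -/
def kernelInt (u : ℝ → Euc N → ℝ) (T t : ℝ) : EucL2 N :=
  ∫ s in Ioo 0 T, max (t - s) 0 ^ 2 • toCurve u s

/-- The derivative of `kernelInt`. -/
def kernelInt' (u : ℝ → Euc N → ℝ) (T t : ℝ) : EucL2 N :=
  ∫ s in Ioo 0 T, (2 * max (t - s) 0) • toCurve u s

theorem kernelInt_zero (T : ℝ) : kernelInt u T 0 = 0 := by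
  refine setIntegral_eq_zero_of_forall_eq_zero fun s hs => ?_
  rw [max_eq_right (by linarith [hs.1])]
  norm_num

variable (hJ : IsLevyKernel J) (hu : IsWeakSolution J u₀ u)
include hJ hu

theorem hasDerivAt_kernelInt {T : ℝ} (hT : 0 < T) (t : ℝ) :
    HasDerivAt (kernelInt u T) (kernelInt' u T t) t :=
  hasDerivAt_integral_kernel_sq (integrable_toCurve hJ hu hT) t

theorem annihilates_kernelInt {U₀ Ψ : EucL2 N} (hU₀ : U₀ =ᵐ[volume] u₀) (hΨ : IsTest Ψ) {T r : ℝ}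
    (hr : 0 ≤ r) (hrT : r ≤ T) (hT : 0 < T) :
    Annihilates (kernelInt' u T r - r ^ 2 • U₀) (kernelInt u T r) Ψ (levyGen J Ψ) := by
  intro z
  have h := weak_eq_kernel hJ hu hU₀ (hΨ.shift z) hr hrT hT
  rw [levyGen_shift hJ hΨ] at h
  rw [inner_sub_left, real_inner_smul_left, ← h]
  simp only [kernelInt, kernelInt']
  ring

/-- Duhamel's formula: integrate the derivative of `⟨X(r), S_n(t - r) Ψ⟩` over `[0, t]`, where `X`
is `kernelInt` and `S_n` the truncated semigroup. The second term is the truncation error, which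
tends to zero with `n`. -/
theorem inner_kernelInt_eq_integral_cutSemi {U₀ Ψ : EucL2 N} (hU₀ : U₀ =ᵐ[volume] u₀)
    (hΨ : IsTest Ψ) {T t : ℝ} (ht : 0 ≤ t) (htT : t ≤ T) (hT : 0 < T) (n : ℕ) :
    ∫ r in (0 : ℝ)..t, (r ^ 2 * inner ℝ (cutSemi hJ n (t - r) U₀) Ψ
      + inner ℝ (kernelInt u T r) (cutSemi hJ n (t - r) (cutGen hJ n Ψ - levyGen J Ψ)))
      = inner ℝ (kernelInt u T t) Ψ := by
  have hXc : Continuous (kernelInt u T) :=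
    continuous_iff_continuousAt.2 fun r => (hasDerivAt_kernelInt hJ hu hT r).continuousAt
  have hSd : ∀ r, HasDerivAt (fun r => cutSemi hJ n (t - r)) (cutSemi hJ n (t - r) * cutGen hJ n) r := by
    intro r
    have := (hasDerivAt_cutSemi hJ n (t - r)).scomp r ((hasDerivAt_id r).const_sub t)
    simpa [Function.comp_def] using this
  have hSc : Continuous fun r => cutSemi hJ n (t - r) :=
    continuous_iff_continuousAt.2 fun r => (hSd r).continuousAt
  have hd : ∀ r ∈ uIcc 0 t, HasDerivAt (fun r => inner ℝ (kernelInt u T r) (cutSemi hJ n (t - r) Ψ))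
      (r ^ 2 * inner ℝ (cutSemi hJ n (t - r) U₀) Ψ
      + inner ℝ (kernelInt u T r) (cutSemi hJ n (t - r) (cutGen hJ n Ψ - levyGen J Ψ))) r := by
    intro r hr
    rw [uIcc_of_le ht] at hr
    have h1 := (hasDerivAt_kernelInt hJ hu hT r).inner ℝ ((hSd r).clm_apply (hasDerivAt_const r Ψ))
    refine h1.congr_deriv ?_
    have := isFiniteMeasure_levyCut hJ n
    have h2 : inner ℝ (kernelInt' u T r - r ^ 2 • U₀) (cutSemi hJ n (t - r) Ψ)
        + inner ℝ (kernelInt u T r) (cutSemi hJ n (t - r) (levyGen J Ψ)) = 0 :=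
      (annihilates_kernelInt hJ hu hU₀ hΨ hr.1 (hr.2.trans htT) hT).inner_semi (levyCut J n) (t - r)
    rw [inner_sub_left, real_inner_smul_left] at h2
    rw [inner_cutSemi_left, mul_apply_eq_comp, map_zero, add_zero, map_sub, inner_sub_right]
    linarith
  rw [intervalIntegral.integral_eq_sub_of_hasDerivAt hd]
  · simp [kernelInt_zero, cutSemi_zero]
  · refine Continuous.intervalIntegrable ?_ _ _
    exact ((continuous_pow 2).mul ((hSc.clm_apply continuous_const).inner continuous_const)).add
      (hXc.inner (hSc.clm_apply continuous_const))

theorem inner_kernelInt_eq_integral_limSemi (hN : 1 ≤ N) {U₀ Ψ : EucL2 N} (hU₀ : U₀ =ᵐ[volume] u₀)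
    (hΨ : IsTest Ψ) {T t : ℝ} (ht : 0 ≤ t) (htT : t ≤ T) (hT : 0 < T) :
    inner ℝ (kernelInt u T t) Ψ = ∫ r in (0 : ℝ)..t, r ^ 2 * inner ℝ (limSemi hJ (t - r) U₀) Ψ := by
  have hXc : Continuous (kernelInt u T) :=
    continuous_iff_continuousAt.2 fun r => (hasDerivAt_kernelInt hJ hu hT r).continuousAt
  obtain ⟨M, hM⟩ := (isCompact_Icc (a := (0 : ℝ)) (b := t)).exists_bound_of_continuousOn
    hXc.continuousOn
  have hG : Tendsto (fun n => cutGen hJ n Ψ - levyGen J Ψ) atTop (𝓝 0) := by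
    simpa using (tendsto_cutGen hJ hN hΨ).sub_const (levyGen J Ψ)
  obtain ⟨C, hC⟩ := hG.norm.bddAbove_range
  have hC' : ∀ n, ‖cutGen hJ n Ψ - levyGen J Ψ‖ ≤ C := fun n => hC ⟨n, rfl⟩
  have hMr : ∀ r ∈ uIoc 0 t, ‖kernelInt u T r‖ ≤ M ∧ 0 ≤ r ∧ 0 ≤ t - r ∧ r ≤ t := by
    intro r hr
    rw [uIoc_of_le ht] at hr
    exact ⟨hM r ⟨hr.1.le, hr.2⟩, hr.1.le, by linarith [hr.2], hr.2⟩
  have hSc : ∀ n, Continuous fun r => cutSemi hJ n (t - r) := fun n => by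
    have hc : Continuous (cutSemi hJ n) :=
      continuous_iff_continuousAt.2 fun t => (hasDerivAt_cutSemi hJ n t).continuousAt
    exact hc.comp (continuous_const.sub continuous_id)
  have hlim := intervalIntegral.tendsto_integral_filter_of_dominated_convergence
    (μ := volume) (a := 0) (b := t) (l := atTop)
    (F := fun n r => r ^ 2 * inner ℝ (cutSemi hJ n (t - r) U₀) Ψ
      + inner ℝ (kernelInt u T r) (cutSemi hJ n (t - r) (cutGen hJ n Ψ - levyGen J Ψ)))
    (f := fun r => r ^ 2 * inner ℝ (limSemi hJ (t - r) U₀) Ψ)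
    (fun _ => t ^ 2 * (‖U₀‖ * ‖Ψ‖) + M * C)
    (Eventually.of_forall fun n => by
      refine Continuous.aestronglyMeasurable ?_
      exact ((continuous_pow 2).mul
        (((hSc n).clm_apply continuous_const).inner continuous_const)).add
        (hXc.inner ((hSc n).clm_apply continuous_const)))
    (Eventually.of_forall fun n => Eventually.of_forall fun r hr => by
      obtain ⟨h1, h2, h3, h4⟩ := hMr r hr
      refine (norm_add_le _ _).trans (add_le_add ?_ ?_)
      · rw [norm_mul, Real.norm_of_nonneg (by positivity)]
        gcongr
        exact (norm_inner_le_norm _ _).trans (by gcongr; exact norm_cutSemi_le hJ n h3 U₀)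
      · refine (norm_inner_le_norm _ _).trans ?_
        have h5 := (norm_cutSemi_le hJ n h3 (cutGen hJ n Ψ - levyGen J Ψ)).trans (hC' n)
        have h6 : 0 ≤ M := (norm_nonneg _).trans h1
        gcongr)
    (intervalIntegrable_const)
    (Eventually.of_forall fun r hr => by
      obtain ⟨h1, h2, h3, h4⟩ := hMr r hr
      have e1 : Tendsto (fun n => inner ℝ (cutSemi hJ n (t - r) U₀) Ψ) atTop
          (𝓝 (inner ℝ (limSemi hJ (t - r) U₀) Ψ)) :=
        (tendsto_cutSemi hJ hN U₀ h3).inner tendsto_const_nhds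
      have e2 : Tendsto (fun n => cutSemi hJ n (t - r) (cutGen hJ n Ψ - levyGen J Ψ)) atTop (𝓝 0) :=
        squeeze_zero_norm (fun n => norm_cutSemi_le hJ n h3 _) (by simpa using hG.norm)
      have e3 := (e1.const_mul (r ^ 2)).add
        ((tendsto_const_nhds (x := kernelInt u T r)).inner (𝕜 := ℝ) e2)
      rwa [inner_zero_right, add_zero] at e3)
  simp only [inner_kernelInt_eq_integral_cutSemi hJ hu hU₀ hΨ ht htT hT] at hlim
  exact tendsto_nhds_unique tendsto_const_nhds hlim

/-- A weak solution is given by the semigroup. -/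
theorem toCurve_ae_eq_limSemi (hN : 1 ≤ N) {U₀ : EucL2 N} (hU₀ : U₀ =ᵐ[volume] u₀) {T : ℝ}
    (hT : 0 < T) :
    ∀ᵐ t ∂(volume.restrict (Ioo 0 T)), toCurve u t = limSemi hJ t U₀ := by
  have hv := integrable_toCurve hJ hu hT
  have hUi : Integrable (fun t => limSemi hJ t U₀) (volume.restrict (Ioo 0 T)) := by
    have hc : ContinuousOn (fun t => limSemi hJ t U₀) (Icc 0 T) :=
      (continuousOn_limSemi hJ hN U₀).mono fun t ht => ht.1
    exact (hc.integrableOn_compact isCompact_Icc).mono_set Ioo_subset_Icc_self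
  have hz := ae_eq_zero_of_integral_kernel_sq_eq_zero (hv.sub hUi) fun t ht => by
    have i1 := integrable_continuous_smul hv (φ := fun s => max (t - s) 0 ^ 2) (by fun_prop)
    have i2 := integrable_continuous_smul hUi (φ := fun s => max (t - s) 0 ^ 2) (by fun_prop)
    simp only [Pi.sub_apply, smul_sub]
    rw [integral_sub i1 i2]
    set Y := (∫ s in Ioo 0 T, max (t - s) 0 ^ 2 • toCurve u s)
      - ∫ s in Ioo 0 T, max (t - s) 0 ^ 2 • limSemi hJ s U₀ with hY
    -- The substitution `s = t - r` puts Duhamel's formula in the form of the squared kernel, so `u`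
    -- and the semigroup orbit have the same kernel integral against test functions, which are
    -- dense.
    have hYΨ : ∀ Ψ, IsTest Ψ → inner ℝ Y Ψ = 0 := by
      intro Ψ hΨ
      have h1 := inner_kernelInt_eq_integral_limSemi hJ hu hN hU₀ hΨ ht.1.le ht.2.le hT
      have h2 := intervalIntegral.integral_comp_sub_left (a := 0) (b := t)
        (fun s => (t - s) ^ 2 * inner ℝ (limSemi hJ s U₀) Ψ) t
      simp only [sub_sub_cancel, sub_self, sub_zero] at h2
      rw [h2, intervalIntegral.integral_of_le ht.1.le] at h1
      have h3 : ∫ s in Ioo 0 T, max (t - s) 0 ^ 2 * inner ℝ (limSemi hJ s U₀) Ψ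
          = ∫ s in Ioc 0 t, (t - s) ^ 2 * inner ℝ (limSemi hJ s U₀) Ψ := by
        rw [setIntegral_eq_of_subset_of_forall_sdiff_eq_zero (s := Ioc 0 t) measurableSet_Ioo
          (fun s hs => ⟨hs.1, hs.2.trans_lt ht.2⟩) (fun s hs => ?_)]
        · refine setIntegral_congr_fun measurableSet_Ioc fun s hs => ?_
          rw [max_eq_left (by linarith [hs.2])]
        · have : t < s := by
            by_contra h
            exact hs.2 ⟨hs.1.1, not_lt.1 h⟩
          rw [max_eq_right (by linarith)]
          ring
      rw [hY, inner_sub_left]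
      have h4 : inner ℝ (∫ s in Ioo 0 T, max (t - s) 0 ^ 2 • limSemi hJ s U₀) Ψ
          = ∫ s in Ioo 0 T, max (t - s) 0 ^ 2 * inner ℝ (limSemi hJ s U₀) Ψ := by
        rw [real_inner_comm, ← integral_inner i2]
        refine integral_congr_ae (Eventually.of_forall fun s => ?_)
        simp only [real_inner_smul_right]
        rw [real_inner_comm]
      rw [h4, h3, ← h1]
      exact sub_self _
    have hall : (fun Φ => inner ℝ Y Φ) = fun _ => (0 : ℝ) :=
      Continuous.ext_on dense_isTest (by fun_prop) continuous_const fun Ψ hΨ => hYΨ Ψ hΨ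
    exact inner_self_eq_zero.1 (congrFun hall Y)
  filter_upwards [hz] with t ht using sub_eq_zero.1 ht

theorem ae_eq_limSemi (hN : 1 ≤ N) {U₀ : EucL2 N} (hU₀ : U₀ =ᵐ[volume] u₀) :
    ∀ᵐ t ∂(volume.restrict (Ioi (0 : ℝ))), u t =ᵐ[volume] limSemi hJ t U₀ := by
  refine ae_Ioi_of_ae_Ioo fun T hT => ?_
  filter_upwards [ae_memLp_and_energy hJ hu hT, toCurve_ae_eq_limSemi hJ hu hN hU₀ hT] with t h1 h2
  rw [← h2]
  exact (coeFn_toCurve h1.1).symm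

end NonlocalHeat

/-! ### Comparison of Lebesgue norms and absorption of the remainder. -/

namespace NonlocalHeat

variable {N : ℕ}

/-- Pointwise `|f| ^ a ≤ |f| + |f| ^ b`. -/
theorem memLp_of_one_of_le {f : Euc N → ℝ} {a b : ℝ} (ha : 1 ≤ a) (hab : a ≤ b)
    (h1 : MemLp f 1 volume) (hb : MemLp f (ENNReal.ofReal b) volume) :
    MemLp f (ENNReal.ofReal a) volume := by
  have ha0 : 0 < a := by linarith
  have hb0 : 0 < b := by linarith
  refine ⟨h1.1, ?_⟩
  have e1 := (eLpNorm_lt_top_iff_lintegral_rpow_enorm_lt_top one_ne_zero ENNReal.one_ne_top).1 h1.2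
  have e2 := (eLpNorm_lt_top_iff_lintegral_rpow_enorm_lt_top (by simpa using hb0)
    ENNReal.ofReal_ne_top).1 hb.2
  rw [eLpNorm_lt_top_iff_lintegral_rpow_enorm_lt_top (by simpa using ha0) ENNReal.ofReal_ne_top]
  rw [ENNReal.toReal_ofReal ha0.le]
  rw [ENNReal.toReal_ofReal hb0.le] at e2
  rw [ENNReal.toReal_one] at e1
  refine lt_of_le_of_lt (lintegral_mono fun x => ?_)
    (lt_of_eq_of_lt (lintegral_add_left' (h1.1.enorm.pow_const 1) _) (ENNReal.add_lt_top.2 ⟨e1, e2⟩))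
  rcases le_total ‖f x‖ₑ 1 with h | h
  · exact (ENNReal.rpow_le_rpow_of_exponent_ge h ha).trans le_self_add
  · exact (ENNReal.rpow_le_rpow_of_exponent_le h hab).trans le_add_self

/-- The `L^q` norms of a function, `q ≥ 1`, are bounded below uniformly in `q`. -/
theorem exists_eLpNorm_le_mul_eLpNorm {f : Euc N → ℝ} {p : ℝ} (hp : 1 ≤ p)
    (hf : MemLp f (ENNReal.ofReal p) volume) :
    ∃ M : ℝ, 0 ≤ M ∧ ∀ q : ℝ, 1 ≤ q →
      eLpNorm f (ENNReal.ofReal p) volume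
        ≤ ENNReal.ofReal M * eLpNorm f (ENNReal.ofReal q) volume := by
  have hp0 : ENNReal.ofReal p ≠ 0 := by
    simpa using by linarith
  by_cases h0 : f =ᵐ[volume] 0
  · refine ⟨0, le_rfl, fun q _ => ?_⟩
    rw [eLpNorm_congr_ae h0, eLpNorm_zero]
    exact zero_le
  obtain ⟨n, hn⟩ : ∃ n : ℕ, volume {x | ENNReal.ofReal (1 / ((n : ℝ) + 1)) ≤ ‖f x‖ₑ} ≠ 0 := by
    by_contra! hcon
    refine h0 ?_
    have : ∀ᵐ x, ∀ n : ℕ, ¬ ENNReal.ofReal (1 / ((n : ℝ) + 1)) ≤ ‖f x‖ₑ :=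
      ae_all_iff.2 fun n => by
        rw [ae_iff]
        simpa using hcon n
    filter_upwards [this] with x hx
    by_contra hne
    obtain ⟨n, hn⟩ := exists_nat_one_div_lt (norm_pos_iff.2 hne)
    refine hx n ?_
    rw [← ofReal_norm]
    exact ENNReal.ofReal_le_ofReal hn.le
  set ε := ENNReal.ofReal (1 / ((n : ℝ) + 1)) with hε
  have hε0 : ε ≠ 0 := (ENNReal.ofReal_pos.2 (by positivity)).ne'
  set A := volume {x | ε ≤ ‖f x‖ₑ} with hA
  -- Chebyshev gives `ε ^ q * A ≤ ‖f‖_q ^ q`. Capping `A` at one yields `(min 1 A) ^ q ≤ A`, so the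
  -- lower bound `δ` does not depend on `q`.
  set δ := ε * min 1 A with hδ
  have hδ0 : δ ≠ 0 := mul_ne_zero hε0 (by simp [hn])
  have hδtop : δ ≠ ∞ := ENNReal.mul_ne_top ENNReal.ofReal_ne_top (by simp)
  have hlow : ∀ q : ℝ, 1 ≤ q → δ ≤ eLpNorm f (ENNReal.ofReal q) volume := by
    intro q hq
    have hq0 : 0 < q := by linarith
    have h1 := mul_meas_ge_le_pow_eLpNorm' volume (p := ENNReal.ofReal q) (by simpa using hq0)
      ENNReal.ofReal_ne_top hf.1 ε
    rw [ENNReal.toReal_ofReal hq0.le] at h1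
    rw [← ENNReal.rpow_le_rpow_iff hq0]
    refine le_trans ?_ h1
    rw [hδ, ENNReal.mul_rpow_of_nonneg _ _ hq0.le]
    gcongr
    refine le_trans ?_ (min_le_right 1 A)
    calc min 1 A ^ q ≤ min 1 A ^ (1 : ℝ) := ENNReal.rpow_le_rpow_of_exponent_ge (min_le_left _ _) hq
      _ = min 1 A := ENNReal.rpow_one _
  refine ⟨(eLpNorm f (ENNReal.ofReal p) volume / δ).toReal, ENNReal.toReal_nonneg, fun q hq => ?_⟩
  rw [ENNReal.ofReal_toReal (ENNReal.div_ne_top hf.2.ne hδ0)]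
  calc eLpNorm f (ENNReal.ofReal p) volume
      = eLpNorm f (ENNReal.ofReal p) volume / δ * δ := (ENNReal.div_mul_cancel hδ0 hδtop).symm
    _ ≤ _ := by gcongr; exact hlow q hq

theorem rpow_decay_le {t t₁ m σ M : ℝ} (ht₁ : 0 < t₁) (ht : 1 ≤ t) (hσ : σ ≤ m - 1)
    (hM : (2 * t₁) ^ m * M ≤ t) : (2 * t₁ / t) ^ m * M ≤ t ^ (-σ) := by
  have ht0 : 0 < t := by linarith
  calc (2 * t₁ / t) ^ m * M = (2 * t₁) ^ m * M * t ^ (-m) := by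
        rw [Real.div_rpow (by positivity) ht0.le, Real.rpow_neg ht0.le]
        ring
    _ ≤ t * t ^ (-m) := by gcongr
    _ = t ^ (1 - m) := by
        rw [sub_eq_add_neg, Real.rpow_add ht0, Real.rpow_one]
    _ ≤ t ^ (-σ) := Real.rpow_le_rpow_of_exponent_le ht (by linarith)

end NonlocalHeat

end

/-! ### The main theorem. -/

open NonlocalHeat in
theorem mainTheorem1 {N : ℕ} (hN : 1 ≤ N)
    (J : EuclideanSpace ℝ (Fin N) → ℝ) (hJ : IsLevyKernel J)
    (α : ℝ) (hα : 0 < α) (hα2 : α ≤ 2)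
    (hJinf : ∃ c : ℝ, 0 < c ∧ ∃ R : ℝ, 0 < R ∧
      ∀ z : EuclideanSpace ℝ (Fin N), R ≤ ‖z‖ → c * ‖z‖ ^ (-(N : ℝ) - α) ≤ J z)
    (p : ℝ) (hp : 1 < p) :
    ∃ C : ℝ, 0 < C ∧
      ∀ u₀ : EuclideanSpace ℝ (Fin N) → ℝ,
        MemLp u₀ 1 volume → MemLp u₀ (ENNReal.ofReal (max p 2)) volume →
        ∃ t₀ : ℝ, 0 < t₀ ∧
          ∀ u : ℝ → EuclideanSpace ℝ (Fin N) → ℝ, IsWeakSolution J u₀ u →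
            -- the weak solution has an `L²`-continuous version `U`, which gives a meaning
            -- to its value at each time
            ∃ U : ℝ → Lp ℝ 2 (volume : Measure (EuclideanSpace ℝ (Fin N))),
              ContinuousOn U (Ici 0) ∧ U 0 =ᵐ[volume] u₀ ∧
              (∀ᵐ t ∂(volume.restrict (Ioi (0 : ℝ))), u t =ᵐ[volume] U t) ∧
              ∀ t : ℝ, t₀ < t → ∀ q : ℝ, 1 ≤ q → q < p →
                eLpNorm (U t) (ENNReal.ofReal p) volume
                  ≤ ENNReal.ofReal (C * t ^ (-((N : ℝ) / α * (1 / q - 1 / p))))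
                    * eLpNorm u₀ (ENNReal.ofReal q) volume := by
  obtain ⟨c, hc, R, hR, hlow⟩ := hJinf
  obtain ⟨t₁, ht₁, B, hB, hdecay⟩ := exists_limSemi_decay_bound (p := p) hJ hN hα hc
    (le_max_right R 2) fun z hz => hlow z ((le_max_left R 2).trans hz)
  -- `B` comes from the smoothing term; the added one pays for the absorbed `L^p` remainder.
  refine ⟨B + 1, by positivity, fun u₀ hu1 hu2 => ?_⟩
  have hup : MemLp u₀ (ENNReal.ofReal p) volume :=
    memLp_of_one_of_le hp.le (le_max_left p 2) hu1 hu2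
  have hul2 : MemLp u₀ 2 volume := by
    have := memLp_of_one_of_le one_le_two (le_max_right p 2) hu1 hu2
    rwa [ENNReal.ofReal_ofNat] at this
  obtain ⟨M, hM0, hM⟩ := exists_eLpNorm_le_mul_eLpNorm hp.le hup
  set m := (N : ℝ) / α + 1 with hm
  -- Beyond the last threshold `(2 t₁ / t) ^ m * M ≤ t ^ (1 - m)`, which is at most `t ^ (-σ)`
  -- because `σ ≤ m - 1` and `t ≥ 1`.
  refine ⟨max (max t₁ 1) ((2 * t₁) ^ m * M), by positivity, fun u hu => ?_⟩
  have hU₀ : hul2.toLp =ᵐ[volume] u₀ := hul2.coeFn_toLp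
  refine ⟨fun t => limSemi hJ t hul2.toLp, continuousOn_limSemi hJ hN _, ?_,
    ae_eq_limSemi hJ hu hN hU₀, ?_⟩
  · change limSemi hJ 0 hul2.toLp =ᵐ[volume] u₀
    rw [limSemi_zero hJ hN]
    exact hU₀
  intro t ht q hq hqp
  simp only [max_lt_iff] at ht
  obtain ⟨⟨ht1, ht2⟩, ht3⟩ := ht
  have ht0 : 0 < t := by linarith
  set σ := (N : ℝ) / α * (1 / q - 1 / p) with hσ
  have hσm : σ ≤ m - 1 := by
    have h1 : 1 / q ≤ 1 := (div_le_one (by linarith)).2 hq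
    have h2 : 0 < 1 / p := by positivity
    have h3 : 0 ≤ (N : ℝ) / α := by positivity
    rw [hσ, hm]
    nlinarith
  have h := hdecay t ht1.le hul2.toLp q hq hqp
  rw [eLpNorm_congr_ae (p := ENNReal.ofReal p) hU₀, eLpNorm_congr_ae (p := ENNReal.ofReal q) hU₀]
    at h
  refine h.trans ?_
  calc _ ≤ ENNReal.ofReal ((2 * t₁ / t) ^ m) * (ENNReal.ofReal M
          * eLpNorm u₀ (ENNReal.ofReal q) volume)
        + ENNReal.ofReal (B * t ^ (-σ)) * eLpNorm u₀ (ENNReal.ofReal q) volume := by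
        gcongr
        exact hM q hq
    _ = ENNReal.ofReal ((2 * t₁ / t) ^ m * M + B * t ^ (-σ))
          * eLpNorm u₀ (ENNReal.ofReal q) volume := by
        rw [ENNReal.ofReal_add (by positivity) (by positivity),
          ENNReal.ofReal_mul (p := (2 * t₁ / t) ^ m) (by positivity)]
        ring
    _ ≤ _ := by
        gcongr
        have := rpow_decay_le ht₁ ht2.le hσm ht3.le
        linarith
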